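/- Let $\alpha\in[1,2]$ and let $X(t,\omega)$, $t\in\mathbb R$, be a symmetric stable process of index $\alpha$: a real process with independent increments such that, for some constant $c>0$, $\mathbb E\,e^{iu(X(t)-X(s))}=e^{-c(t-s)|u|^\alpha}$ for all $s\le t$ and $u\in\mathbb R$. For $g$ continuous on $[-1,1]$, the stochastic integral $\int_{-1}^1 g(t)\,dX(t,\omega)$ is the limit in probability of the Riemann–Stieltjes sums $\sum_i g(\xi_i)\,(X(x_{i+1})-X(x_i))$ as the mesh of the tagged partition tends to $0$; for $h\in L^\alpha[-1,1]$, $\int_{-1}^1 h(t)\,dX(t,\omega)$ is the limit in probability of $\int_{-1}^1 g_k(t)\,dX(t,\omega)$ for continuous $g_k\to h$ in $L^\alpha[-1,1]$. Put $\rho^{(\gamma,\delta)}(t)=(1-t)^\gamma(1+t)^\delta$ and $$u_n(y)=\Big[\frac{(2n+1)\,\Gamma(n+1)^2}{2\,\Gamma(n+3/2)\,\Gamma(n+1/2)}\Big]^{1/2}P_n^{(1/2,-1/2)}(y),$$ where $P_n^{(1/2,-1/2)}$ is the classical Jacobi polynomial with $P_n^{(1/2,-1/2)}(1)=\binom{n+1/2}{n}$,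 so that the $u_n$ are orthonormal on $[-1,1]$ with respect to $\rho^{(1/2,-1/2)}$. Let $f:[-1,1]\to\mathbb R$ have a continuous $p$th derivative which satisfies a Lipschitz condition of order $\mu$, $|f^{(p)}(x)-f^{(p)}(y)|\le C|x-y|^\mu$ on $[-1,1]$, where $p\in\mathbb N$, $0<\mu<1$ and $p+\mu\ge 5/2$; let $b_n=\int_{-1}^1 f(t)u_n(t)\rho^{(1/2,-1/2)}(t)\,dt$, and let $\eta,\tau\ge 0$. Then: 1. The stochastic integrals $B_n(\omega)=\int_{-1}^1u_n(t)\rho^{(\eta,\tau)}(t)\,dX(t,\omega)$, $n\ge0$, exist. 2. The series $f(y,t):=\sum_{k=0}^\infty b_k\,u_k(y)\,u_k(t)$ converges absolutely for all $(y,t)\in[-1,1]^2$ with $(y,t)\ne(1,1)$, and for each $y\in[-1,1]$ the function $t\mapsto f(y,t)\rho^{(\eta,\tau)}(t)$ is in $L^\alpha[-1,1]$ and its stochastic integral $\int_{-1}^1 f(y,t)\rho^{(\eta,\tau)}(t)\,dX(t,\omega)$ exists. 3. For each $y\in[-1,1]$, the random series $\sum_{n=0}^\infty b_nB_n(\omega)u_n(y)$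 converges in probability to $\int_{-1}^1 f(y,t)\rho^{(\eta,\tau)}(t)\,dX(t,\omega)$. -/

import Mathlib

open MeasureTheory ProbabilityTheory Filter Topology Set

namespace RandomJacobi

noncomputable section

/-! ### Jacobi polynomials and Fourier-Jacobi coefficients -/

/-- The Jacobi weight `ρ^(γ,δ)(t) = (1 - t)^γ (1 + t)^δ` on `[-1, 1]`. -/
def jacobiWeight (γ δ t : ℝ) : ℝ := (1 - t) ^ γ * (1 + t) ^ δ

/-- The classical Jacobi polynomial of degree `n`, normalized by `P_n(1) = binom (n + γ) n`:
`P_n(x) = ∑ₛ binom (n + γ) (n - s) * binom (n + δ) s * ((x - 1)/2)^s * ((x + 1)/2)^(n - s)`,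
with generalized binomial coefficients. -/
def jacobiP (γ δ : ℝ) (n : ℕ) (x : ℝ) : ℝ :=
  ∑ s ∈ Finset.range (n + 1),
    Ring.choose ((n : ℝ) + γ) (n - s) * Ring.choose ((n : ℝ) + δ) s *
      ((x - 1) / 2) ^ s * ((x + 1) / 2) ^ (n - s)

/-- The weighted Jacobi polynomials `u_n^(1/2,-1/2)`; they are orthonormal on `[-1, 1]` with respect
to the weight `ρ^(1/2,-1/2)`. -/
def jacobiU (n : ℕ) (y : ℝ) : ℝ :=
  Real.sqrt ((2 * (n : ℝ) + 1) * Real.Gamma ((n : ℝ) + 1) * Real.Gamma ((n : ℝ) + 1) /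
      (2 * Real.Gamma ((n : ℝ) + 3 / 2) * Real.Gamma ((n : ℝ) + 1 / 2))) *
    jacobiP (1 / 2) (-1 / 2) n y

/-- The Fourier-Jacobi coefficients `b_n` of `f` with respect to `u_n^(1/2,-1/2)`. -/
def jacobiCoeff (f : ℝ → ℝ) (n : ℕ) : ℝ :=
  ∫ t in (-1 : ℝ)..1, f t * jacobiU n t * jacobiWeight (1 / 2) (-1 / 2) t

/-- The function `f(y, t)`: the sum of the series `∑ₖ b_k u_k(y) u_k(t)`. -/
def jacobiSum (f : ℝ → ℝ) (y t : ℝ) : ℝ :=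
  ∑' k, jacobiCoeff f k * jacobiU k y * jacobiU k t

/-- The class `LC^(p,μ)` on `[-1, 1]`: the `p`-th derivative exists, is continuous and
satisfies a Lipschitz (Hölder) condition of order `μ`. -/
def LipClass (p : ℕ) (μ : ℝ) (f : ℝ → ℝ) : Prop :=
  ContDiffOn ℝ p f (Icc (-1) 1) ∧
    ∃ C : ℝ, ∀ x ∈ Icc (-1 : ℝ) 1, ∀ y ∈ Icc (-1 : ℝ) 1,
      |iteratedDerivWithin p f (Icc (-1) 1) x - iteratedDerivWithin p f (Icc (-1) 1) y| ≤
        C * |x - y| ^ μ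

/-! ### Symmetric stable processes and stochastic integrals -/

/-- `X` is a symmetric stable process of index `α`: it has independent increments and, for some
`c > 0`, the increment over `[s, t]` has characteristic function `exp (-c (t - s) |u|^α)`. -/
structure IsSymmetricStable {Ω : Type*} [MeasurableSpace Ω] (X : ℝ → Ω → ℝ) (α : ℝ)
    (P : Measure Ω) : Prop where
  aemeasurable : ∀ t, AEMeasurable (X t) P
  indepIncrements : HasIndepIncrements X P
  charFun_increment : ∃ c : ℝ, 0 < c ∧ ∀ s t : ℝ, s ≤ t → ∀ u : ℝ,
    charFun (P.map (fun ω => X t ω - X s ω)) u =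
      ((Real.exp (-(c * (t - s) * |u| ^ α)) : ℝ) : ℂ)

/-- A partition `a = x₀ ≤ x₁ ≤ ... ≤ xₙ = b` with a tag `ξᵢ` in each `[xᵢ, xᵢ₊₁]`. -/
structure TaggedPart (a b : ℝ) where
  n : ℕ
  pt : Fin (n + 1) → ℝ
  mono : Monotone pt
  left : pt 0 = a
  right : pt (Fin.last n) = b
  tag : Fin n → ℝ
  tag_mem : ∀ i : Fin n, tag i ∈ Icc (pt i.castSucc) (pt i.succ)

/-- The mesh of a tagged partition, the largest length of one of its intervals. -/
def TaggedPart.mesh {a b : ℝ} (π : TaggedPart a b) : ℝ :=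
  ⨆ i : Fin π.n, (π.pt i.succ - π.pt i.castSucc)

/-- The Riemann-Stieltjes sum `∑ᵢ g(ξᵢ) (X(xᵢ₊₁) - X(xᵢ))`. -/
def rsSum {Ω : Type*} (X : ℝ → Ω → ℝ) (g : ℝ → ℝ) {a b : ℝ} (π : TaggedPart a b) (ω : Ω) : ℝ :=
  ∑ i : Fin π.n, g (π.tag i) * (X (π.pt i.succ) ω - X (π.pt i.castSucc) ω)

/-- `J` is the stochastic integral `∫ₐᵇ g(t) dX(t, ω)` of a continuous function `g`: the limit in
probability of the Riemann-Stieltjes sums as the mesh of the partition tends to `0`. -/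
def IsRSIntegral {Ω : Type*} [MeasurableSpace Ω] (P : Measure Ω) (X : ℝ → Ω → ℝ)
    (a b : ℝ) (g : ℝ → ℝ) (J : Ω → ℝ) : Prop :=
  ContinuousOn g (Icc a b) ∧ AEMeasurable J P ∧
    TendstoInMeasure P (fun π : TaggedPart a b => rsSum X g π)
      (comap TaggedPart.mesh (𝓝 0)) J

/-- `I` is the stochastic integral `∫ₐᵇ h(t) dX(t, ω)` of a function `h ∈ L^α[a, b]`: the limit in
probability of the stochastic integrals of continuous functions which converge to `h` in
`L^α[a, b]`. -/
def IsStochIntegral {Ω : Type*} [MeasurableSpace Ω] (P : Measure Ω) (X : ℝ → Ω → ℝ) (α : ℝ)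
    (a b : ℝ) (h : ℝ → ℝ) (I : Ω → ℝ) : Prop :=
  MemLp h (ENNReal.ofReal α) (volume.restrict (Icc a b)) ∧ AEMeasurable I P ∧
    ∃ (g : ℕ → ℝ → ℝ) (J : ℕ → Ω → ℝ),
      (∀ k, IsRSIntegral P X a b (g k) (J k)) ∧
      Tendsto (fun k => eLpNorm (fun t => g k t - h t) (ENNReal.ofReal α)
        (volume.restrict (Icc a b))) atTop (𝓝 0) ∧
      TendstoInMeasure P J atTop I

end

end RandomJacobi

/-! For a symmetric stable process the integral of `h` has the symmetric stable law with scale `c *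
‖h‖_α ^ α`. This holds for step functions because characteristic functions of independent increments
multiply, and it survives limits in probability. The tail of a stable law is bounded by its scale,
so integrals tend to `0` in probability when their integrands tend to `0` in `L^α`. This gives
existence of the integrals, and it reduces the theorem to `L^α` convergence of the deterministic
series `∑ b_k u_k(y) u_k(t) ρ(t)` (`HasStableIncrements.tendstoInMeasure_sum`).

The deterministic part rests on `jacobiU_cos`: `u_n(cos θ) sin(θ/2) = sin((n + 1/2)θ) / √π`. Hence
`|u_n| ≤ 2n + 1` and `|u_n(t)| ≤ ((1 - t)/2)^(-1/2)`. The first bound in both variables is too large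
to sum; the second is not in `L^2`. Interpolating them in `t` gives `|u_n(t)| ≤ 2 (2n + 1)^(1/4) (1
- t)^(-3/8)`, which lies in `L^2`.

By the same formula `b_n` is a multiple of the difference of two consecutive cosine coefficients of
`f(cos θ)`. Two integrations by parts and Hölder continuity of order `1/2` of the second derivative
give `b_n = O(n^(-5/2))`. Then `∑ |b_n| (2n + 1)^(5/4)` converges, and it controls the series in
`L^α` for every `α ≤ 2`. -/

namespace RandomJacobi

/-! ### Convergence in probability -/

section Measure

variable {Ω ι : Type*} [MeasurableSpace Ω] {P : Measure Ω}

theorem tendstoInMeasure_zero_of_le {Y Z : ι → Ω → ℝ} {l : Filter ι} {y : Ω → ℝ}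
    (hZ : TendstoInMeasure P Z l (fun _ => 0)) (C : ℝ)
    (h : ∀ i ω, |Y i ω - y ω| ≤ C * |Z i ω|) :
    TendstoInMeasure P Y l y := by
  rw [tendstoInMeasure_iff_norm] at *
  intro ε hε
  refine tendsto_of_tendsto_of_tendsto_of_le_of_le tendsto_const_nhds
    (hZ (ε / (|C| + 1)) (by positivity)) (fun _ => zero_le) fun i => measure_mono fun ω hω => ?_
  simp only [mem_ofPred_eq, Real.norm_eq_abs, sub_zero] at hω ⊢
  rw [div_le_iff₀ (by positivity)]
  have h1 : C * |Z i ω| ≤ |C| * |Z i ω| := mul_le_mul_of_nonneg_right (le_abs_self C) (abs_nonneg _)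
  nlinarith [h i ω, abs_nonneg (Z i ω)]

theorem TendstoInMeasure.add_real {Y Z : ι → Ω → ℝ} {l : Filter ι} {y z : Ω → ℝ}
    (hY : TendstoInMeasure P Y l y) (hZ : TendstoInMeasure P Z l z) :
    TendstoInMeasure P (fun i ω => Y i ω + Z i ω) l (fun ω => y ω + z ω) := by
  rw [tendstoInMeasure_iff_norm] at *
  intro ε hε
  have h := (hY (ε / 2) (by positivity)).add (hZ (ε / 2) (by positivity))
  rw [add_zero] at h
  refine tendsto_of_tendsto_of_tendsto_of_le_of_le tendsto_const_nhds h (fun _ => zero_le)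
    fun i => (measure_mono fun ω hω => ?_).trans (measure_union_le _ _)
  simp only [mem_ofPred_eq, mem_union, Real.norm_eq_abs] at hω ⊢
  by_contra! hc
  have h1 := abs_add_le (Y i ω - y ω) (Z i ω - z ω)
  rw [show Y i ω - y ω + (Z i ω - z ω) = Y i ω + Z i ω - (y ω + z ω) by ring] at h1
  linarith [hc.1, hc.2]

theorem TendstoInMeasure.const_mul_real {Y : ι → Ω → ℝ} {l : Filter ι} {y : Ω → ℝ}
    (hY : TendstoInMeasure P Y l y) (r : ℝ) :
    TendstoInMeasure P (fun i ω => r * Y i ω) l (fun ω => r * y ω) := by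
  have h : TendstoInMeasure P (fun i ω => Y i ω - y ω) l (fun _ => 0) := by
    rw [tendstoInMeasure_iff_norm] at *
    simpa using hY
  refine tendstoInMeasure_zero_of_le h |r| fun i ω => ?_
  rw [← mul_sub, abs_mul]

/-- A family which is Cauchy in probability along a filter converges in probability. -/
theorem exists_tendstoInMeasure_of_cauchy [IsFiniteMeasure P] {Y : ι → Ω → ℝ} {l : Filter ι}
    [l.NeBot] (hY : ∀ i, AEMeasurable (Y i) P)
    (hc : TendstoInMeasure P (fun (q : ι × ι) ω => Y q.1 ω - Y q.2 ω) (l ×ˢ l) (fun _ => 0)) :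
    ∃ J : Ω → ℝ, AEMeasurable J P ∧ TendstoInMeasure P Y l J := by
  rw [tendstoInMeasure_iff_norm] at hc
  simp only [sub_zero, Real.norm_eq_abs] at hc
  have key : ∀ ε : ℝ, 0 < ε → ∀ δ : ENNReal, 0 < δ → ∃ s ∈ l, ∀ i ∈ s, ∀ j ∈ s,
      P {ω | ε ≤ |Y i ω - Y j ω|} ≤ δ := by
    intro ε hε δ hδ
    have h1 := (ENNReal.tendsto_nhds_zero.1 (hc ε hε)) δ hδ
    obtain ⟨s, hs, t, ht, hst⟩ := mem_prod_iff.1 h1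
    exact ⟨s ∩ t, inter_mem hs ht, fun i hi j hj => hst (mk_mem_prod hi.1 hj.2)⟩
  -- A sequence of indices `i k` is taken from nested intersections of Cauchy sets, so consecutive
  -- terms differ by `2^(-k)` with probability at most `2^(-k)`. Borel–Cantelli then yields an
  -- almost sure limit along it.
  choose s hs hsP using fun k : ℕ => key ((1 / 2 : ℝ) ^ k) (by positivity)
    ((1 / 2 : ENNReal) ^ k) (by apply ENNReal.pow_pos; simp)
  have hne : ∀ k, (⋂ m ∈ Finset.range (k + 1), s m).Nonempty := fun k =>
    Filter.nonempty_of_mem ((biInter_finset_mem _).2 fun m _ => hs m)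
  choose i hi using hne
  have hi' : ∀ m k, m ≤ k → i k ∈ s m := fun m k h =>
    mem_iInter₂.1 (hi k) m (Finset.mem_range.2 (by omega))
  have hbc : ∀ᵐ ω ∂P, ∀ᶠ k in atTop, |Y (i k) ω - Y (i (k + 1)) ω| < (1 / 2 : ℝ) ^ k := by
    have := measure_setOfPred_frequently_eq_zero (μ := P)
      (p := fun k ω => (1 / 2 : ℝ) ^ k ≤ |Y (i k) ω - Y (i (k + 1)) ω|) (by
        refine ne_top_of_le_ne_top ?_ (ENNReal.tsum_le_tsum fun k =>
          hsP k _ (hi' k k le_rfl) _ (hi' k (k + 1) (by omega)))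
        rw [ENNReal.tsum_geometric]
        simp)
    rw [ae_iff]
    simpa [Filter.Frequently, not_le] using this
  have hlim : ∀ᵐ ω ∂P, ∃ x, Tendsto (fun k => Y (i k) ω) atTop (𝓝 x) := by
    filter_upwards [hbc] with ω hω
    obtain ⟨N, hN⟩ := eventually_atTop.1 hω
    have : CauchySeq fun k => Y (i (k + N)) ω := by
      refine cauchySeq_of_le_geometric (1 / 2) ((1 / 2) ^ N) (by norm_num) fun k => ?_
      rw [Real.dist_eq]
      have := hN (k + N) (by omega)
      rw [pow_add, mul_comm] at this
      rw [show k + 1 + N = k + N + 1 by omega]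
      exact this.le
    obtain ⟨x, hx⟩ := cauchySeq_tendsto_of_complete this
    exact ⟨x, (tendsto_add_atTop_iff_nat (f := fun k => Y (i k) ω) N).1 hx⟩
  obtain ⟨J, hJm, hJ⟩ := measurable_limit_of_tendsto_metrizable_ae (fun k => hY (i k)) hlim
  have hJt : TendstoInMeasure P (fun k => Y (i k)) atTop J :=
    tendstoInMeasure_of_tendsto_ae (fun k => (hY _).aestronglyMeasurable) hJ
  refine ⟨J, hJm.aemeasurable, ?_⟩
  rw [tendstoInMeasure_iff_norm] at hJt ⊢
  intro ε hε
  rw [ENNReal.tendsto_nhds_zero]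
  intro δ hδ
  obtain ⟨s', hs', hs'P⟩ := key (ε / 2) (by positivity) (δ / 2) (ENNReal.half_pos hδ.ne')
  obtain ⟨m, hm⟩ := exists_pow_lt_of_lt_one (show (0 : ℝ) < ε / 4 by positivity)
    (show (1 / 2 : ℝ) < 1 by norm_num)
  have h2 := (ENNReal.tendsto_nhds_zero.1 (hJt (ε / 4) (by positivity))) (δ / 4)
    (ENNReal.div_pos hδ.ne' (by simp))
  have hpow : Tendsto (fun k : ℕ => (1 / 2 : ENNReal) ^ k) atTop (𝓝 0) :=
    ENNReal.tendsto_pow_atTop_nhds_zero_of_lt_one (by simp)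
  obtain ⟨k, hk1, hk2, hk3⟩ := (h2.and ((eventually_ge_atTop m).and
    ((ENNReal.tendsto_nhds_zero.1 hpow) (δ / 4) (ENNReal.div_pos hδ.ne' (by simp))))).exists
  -- Back from the sequence to the filter: every `j` in `s k` is close to `i k`, whose variable is
  -- already close to `J`.
  filter_upwards [hs k] with j hj
  have hsub : {ω | ε ≤ ‖Y j ω - J ω‖} ⊆
      {ω | (1 / 2 : ℝ) ^ k ≤ |Y j ω - Y (i k) ω|} ∪ {ω | ε / 4 ≤ ‖Y (i k) ω - J ω‖} := by
    intro ω hω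
    simp only [mem_ofPred_eq, mem_union, Real.norm_eq_abs] at hω ⊢
    by_contra! hcon
    have h1 := abs_sub_le (Y j ω) (Y (i k) ω) (J ω)
    have h3 : (1 / 2 : ℝ) ^ k ≤ (1 / 2) ^ m :=
      pow_le_pow_of_le_one (by norm_num) (by norm_num) hk2
    linarith [hcon.1, hcon.2]
  calc P {ω | ε ≤ ‖Y j ω - J ω‖} ≤ _ := (measure_mono hsub).trans (measure_union_le _ _)
    _ ≤ δ / 4 + δ / 4 := add_le_add ((hsP k j hj _ (hi' k k le_rfl)).trans hk3) hk1
    _ ≤ δ / 2 + δ / 2 := by gcongr <;> norm_num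
    _ = δ := ENNReal.add_halves δ

end Measure

/-! ### Symmetric stable laws: tails and limits -/

section StableLaw

variable {Ω ι : Type*} [MeasurableSpace Ω] {P : Measure Ω}

/-- The random variable `Y` has the symmetric stable law of index `α` and scale `κ`. -/
def HasStableLaw (P : Measure Ω) (α κ : ℝ) (Y : Ω → ℝ) : Prop :=
  AEMeasurable Y P ∧ ∀ u : ℝ, charFun (P.map Y) u = ((Real.exp (-(κ * |u| ^ α)) : ℝ) : ℂ)

/-- The tail is at most `ε/2` times the integral of `1 - charFun` over an interval of length `4/ε`,
and `1 - exp(-x) ≤ x` bounds the integrand. -/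
theorem HasStableLaw.measureReal_le [IsProbabilityMeasure P] {α κ : ℝ} (hα : 0 ≤ α) (hκ : 0 ≤ κ)
    {Y : Ω → ℝ} (hY : HasStableLaw P α κ Y) {ε : ℝ} (hε : 0 < ε) :
    P.real {ω | ε < |Y ω|} ≤ 2 * (κ * (2 * ε⁻¹) ^ α) := by
  have : IsProbabilityMeasure (P.map Y) := Measure.isProbabilityMeasure_map hY.1
  have h1 := measureReal_abs_gt_le_integral_charFun (μ := P.map Y) hε
  rw [map_measureReal_apply_of_aemeasurable hY.1 (measurableSet_lt measurable_const (by fun_prop))] at h1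
  refine h1.trans ?_
  have h2 : ‖∫ t in (-2 * ε⁻¹)..(2 * ε⁻¹), 1 - charFun (P.map Y) t‖ ≤
      (κ * (2 * ε⁻¹) ^ α) * |2 * ε⁻¹ - (-2 * ε⁻¹)| := by
    refine intervalIntegral.norm_integral_le_of_norm_le_const fun t ht => ?_
    rw [uIoc_of_le (by have := inv_pos.2 hε; linarith)] at ht
    have h3 : |t| ≤ 2 * ε⁻¹ := abs_le.2 ⟨by linarith [ht.1], ht.2⟩
    rw [hY.2 t, ← Complex.ofReal_one, ← Complex.ofReal_sub, Complex.norm_real, Real.norm_eq_abs]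
    have h4 : 0 ≤ κ * |t| ^ α := by positivity
    have h5 : κ * |t| ^ α ≤ κ * (2 * ε⁻¹) ^ α := by gcongr
    have h6 := Real.add_one_le_exp (-(κ * |t| ^ α))
    have h7 : Real.exp (-(κ * |t| ^ α)) ≤ 1 := Real.exp_le_one_iff.2 (by linarith)
    rw [abs_of_nonneg (by linarith)]
    linarith
  calc _ ≤ 2⁻¹ * ε * ((κ * (2 * ε⁻¹) ^ α) * |2 * ε⁻¹ - (-2 * ε⁻¹)|) := by gcongr
    _ = _ := by
      rw [show 2 * ε⁻¹ - (-2 * ε⁻¹) = 4 * ε⁻¹ by ring, abs_of_pos (by positivity)]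
      field_simp
      ring

theorem tendstoInMeasure_zero_of_hasStableLaw [IsProbabilityMeasure P] {α : ℝ} (hα : 0 ≤ α)
    {κ : ι → ℝ} {Y : ι → Ω → ℝ} {l : Filter ι} (hκ : ∀ᶠ i in l, 0 ≤ κ i)
    (hY : ∀ᶠ i in l, HasStableLaw P α (κ i) (Y i))
    (hκ0 : Tendsto κ l (𝓝 0)) : TendstoInMeasure P Y l (fun _ => 0) := by
  rw [tendstoInMeasure_iff_measureReal_norm]
  intro ε hε
  -- The tail bound concerns a strict inequality; `ε / 2` absorbs the weak one.
  have h : Tendsto (fun i => 2 * (κ i * (2 * (ε / 2)⁻¹) ^ α)) l (𝓝 0) := by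
    simpa using (hκ0.mul_const ((2 * (ε / 2)⁻¹) ^ α)).const_mul 2
  refine tendsto_of_tendsto_of_tendsto_of_le_of_le' tendsto_const_nhds h
    (Eventually.of_forall fun _ => measureReal_nonneg) ?_
  filter_upwards [hκ, hY] with i h1 h2
  refine le_trans (measureReal_mono fun ω hω => ?_) (h2.measureReal_le hα h1 (half_pos hε))
  simp only [sub_zero, Real.norm_eq_abs, mem_ofPred_eq] at hω ⊢
  linarith

/-- Along an almost surely convergent subsequence, which exists as the filter is countably
generated, the characteristic functions converge by dominated convergence. -/
theorem HasStableLaw.of_tendstoInMeasure [IsProbabilityMeasure P] {α κ₀ : ℝ}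
    {κ : ι → ℝ} {Y : ι → Ω → ℝ} {Y₀ : Ω → ℝ} {l : Filter ι} [l.NeBot] [l.IsCountablyGenerated]
    (hY : ∀ i, HasStableLaw P α (κ i) (Y i)) (hκ : Tendsto κ l (𝓝 κ₀))
    (hlim : TendstoInMeasure P Y l Y₀) : HasStableLaw P α κ₀ Y₀ := by
  have hm : AEMeasurable Y₀ P := hlim.aemeasurable fun i => (hY i).1
  refine ⟨hm, fun u => ?_⟩
  obtain ⟨ns, hns, hae⟩ := hlim.exists_seq_tendsto_ae'
  have hc : ∀ Z : Ω → ℝ, AEMeasurable Z P →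
      charFun (P.map Z) u = ∫ ω, Complex.exp (u * Z ω * Complex.I) ∂P := by
    intro Z hZ
    rw [charFun_apply_real, integral_map hZ (by fun_prop)]
  have h1 : Tendsto (fun k => charFun (P.map (Y (ns k))) u) atTop (𝓝 (charFun (P.map Y₀) u)) := by
    simp_rw [hc _ hm, hc _ (hY _).1]
    refine tendsto_integral_of_dominated_convergence (fun _ => (1 : ℝ)) (fun k => ?_)
      (integrable_const _) (fun k => ae_of_all _ fun ω => ?_) ?_
    · have := (hY (ns k)).1
      exact AEMeasurable.aestronglyMeasurable (by fun_prop)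
    · rw [← Complex.ofReal_mul, Complex.norm_exp_ofReal_mul_I]
    · filter_upwards [hae] with ω hω
      have hcont : Continuous fun x : ℝ => Complex.exp (u * x * Complex.I) := by fun_prop
      exact (hcont.tendsto _).comp hω
  have h2 : Tendsto (fun k => charFun (P.map (Y (ns k))) u) atTop
      (𝓝 ((Real.exp (-(κ₀ * |u| ^ α)) : ℝ) : ℂ)) := by
    simp_rw [(hY _).2]
    have hcont : Continuous fun x : ℝ => ((Real.exp (-(x * |u| ^ α)) : ℝ) : ℂ) := by fun_prop
    exact (hcont.tendsto _).comp (hκ.comp hns)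
  exact tendsto_nhds_unique h1 h2

end StableLaw

/-! ### Tagged partitions, step functions and Riemann sums -/

section StepFunctions

/-- Telescoping, with indicator coefficients so that sums over coarser partitions become linear
combinations of the increments of one fine grid. -/
theorem sub_eq_sum_increments {m : ℕ} (F : Fin (m + 1) → ℝ) (q : Fin (m + 1)) :
    F q - F 0 = ∑ j : Fin m, (if j.castSucc < q then (1 : ℝ) else 0) *
      (F j.succ - F j.castSucc) := by
  induction q using Fin.induction with
  | zero => simp
  | succ i ih =>
    have h : ∀ j : Fin m, (if j.castSucc < i.succ then (1 : ℝ) else 0) =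
        (if j.castSucc < i.castSucc then (1 : ℝ) else 0) + if j = i then 1 else 0 := by
      intro j
      rcases lt_trichotomy j i with h | h | h
      · have h1 : j.castSucc < i.succ := by simp [Fin.lt_def]; omega
        simp [h1, h, h.ne]
      · subst h; simp [Fin.lt_def]
      · have h1 : ¬ j.castSucc < i.succ := by simp only [Fin.lt_def, Fin.val_castSucc, Fin.val_succ]; omega
        simp [h1, h.not_gt, h.ne']
    simp_rw [h, add_mul, Finset.sum_add_distrib, ← ih]
    simp

theorem sum_increments {m : ℕ} (F : Fin (m + 1) → ℝ) :
    ∑ j : Fin m, (F j.succ - F j.castSucc) = F (Fin.last m) - F 0 := by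
  rw [sub_eq_sum_increments]
  simp [Fin.castSucc_lt_last]

variable {a b : ℝ}

/-- The right-continuous step function which takes the value `g(ξᵢ)` on `[xᵢ, xᵢ₊₁)`. -/
noncomputable def TaggedPart.stepFun (g : ℝ → ℝ) (π : TaggedPart a b) (x : ℝ) : ℝ :=
  ∑ i : Fin π.n, g (π.tag i) *
    ((if x < π.pt i.succ then 1 else 0) - if x < π.pt i.castSucc then 1 else 0)

theorem TaggedPart.length_le_mesh (π : TaggedPart a b) (i : Fin π.n) :
    π.pt i.succ - π.pt i.castSucc ≤ π.mesh :=
  le_ciSup (f := fun i : Fin π.n => π.pt i.succ - π.pt i.castSucc) (Set.finite_range _).bddAbove i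

theorem TaggedPart.pt_mem (π : TaggedPart a b) (i : Fin (π.n + 1)) : π.pt i ∈ Icc a b :=
  
  ⟨π.left.symm.trans_le (π.mono (Fin.zero_le i)), (π.mono (Fin.le_last i)).trans_eq π.right⟩

theorem TaggedPart.tag_mem_Icc (π : TaggedPart a b) (i : Fin π.n) : π.tag i ∈ Icc a b :=
  ⟨(π.pt_mem _).1.trans (π.tag_mem i).1, (π.tag_mem i).2.trans (π.pt_mem _).2⟩

/-- The difference of indicators is nonzero only on the interval `[xᵢ, xᵢ₊₁)` that contains `x`;
degenerate intervals contribute nothing. -/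
theorem TaggedPart.exists_stepFun_eq (g : ℝ → ℝ) (π : TaggedPart a b) {x : ℝ} (hx : x ∈ Ico a b) :
    ∃ i, π.stepFun g x = g (π.tag i) ∧ |π.tag i - x| ≤ π.mesh := by
  have hex : ∃ i : Fin π.n, π.pt i.castSucc ≤ x ∧ x < π.pt i.succ := by
    by_contra! h
    have : ∀ j, π.pt j ≤ x := by
      intro j
      induction j using Fin.induction with
      | zero => rw [π.left]; exact hx.1
      | succ i ih => exact h i ih
    have h2 := this (Fin.last _)
    rw [π.right] at h2
    exact absurd hx.2 (not_lt.2 h2)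
  obtain ⟨i, hi1, hi2⟩ := hex
  refine ⟨i, ?_, ?_⟩
  · rw [TaggedPart.stepFun, Finset.sum_eq_single i]
    · simp [hi2, hi1.not_gt]
    · intro k _ hk
      rcases lt_or_gt_of_ne hk with h | h
      · have h1 : π.pt k.succ ≤ x := (π.mono (by simp [Fin.le_def]; omega)).trans hi1
        have h2 : π.pt k.castSucc ≤ x := (π.mono (by simp [Fin.le_def])).trans h1
        simp [h1.not_gt, h2.not_gt]
      · have h1 : x < π.pt k.castSucc := hi2.trans_le (π.mono (by simp [Fin.le_def]; omega))
        have h2 : x < π.pt k.succ := h1.trans_le (π.mono (by simp [Fin.le_def]))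
        simp [h1, h2]
    · simp
  · have h1 := π.tag_mem i
    have h2 := π.length_le_mesh i
    rw [abs_le]
    constructor <;> linarith [h1.1, h1.2]

/-- The Riemann-Stieltjes sum of a partition, written on a refinement of the partition. -/
theorem rsSum_eq_sum_stepFun {Ω : Type*} (X : ℝ → Ω → ℝ) (g : ℝ → ℝ) (π : TaggedPart a b)
    {m : ℕ} {t : Fin (m + 1) → ℝ} (ht : StrictMono t) (hπ : ∀ i, π.pt i ∈ range t) (ω : Ω) :
    rsSum X g π ω = ∑ j : Fin m, π.stepFun g (t j.castSucc) *
      (X (t j.succ) ω - X (t j.castSucc) ω) := by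
  have h : ∀ i, X (π.pt i) ω - X (t 0) ω = ∑ j : Fin m,
      (if t j.castSucc < π.pt i then (1 : ℝ) else 0) * (X (t j.succ) ω - X (t j.castSucc) ω) := by
    intro i
    obtain ⟨q, hq⟩ := hπ i
    rw [← hq]
    simp_rw [ht.lt_iff_lt]
    exact sub_eq_sum_increments (fun j => X (t j) ω) q
  simp_rw [rsSum, TaggedPart.stepFun, Finset.sum_mul]
  rw [Finset.sum_comm]
  refine Finset.sum_congr rfl fun i _ => ?_
  rw [← sub_sub_sub_cancel_right _ _ (X (t 0) ω), h, h, ← Finset.sum_sub_distrib, Finset.mul_sum]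
  refine Finset.sum_congr rfl fun j _ => ?_
  ring

theorem exists_common_refinement (π π' : TaggedPart a b) :
    ∃ (m : ℕ) (t : Fin (m + 1) → ℝ), StrictMono t ∧ (∀ j, t j ∈ Icc a b) ∧
      (∀ i, π.pt i ∈ range t) ∧ ∀ i, π'.pt i ∈ range t := by
  classical
  set T : Finset ℝ := Finset.univ.image π.pt ∪ Finset.univ.image π'.pt with hT
  have hne : T.Nonempty := ⟨π.pt 0, by simp [hT]⟩
  obtain ⟨m, hm⟩ := Nat.exists_eq_succ_of_ne_zero hne.card_pos.ne'
  -- The increasing enumeration of the union of the two point sets.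
  refine ⟨m, T.orderEmbOfFin hm, (T.orderEmbOfFin hm).strictMono, fun j => ?_, ?_, ?_⟩
  · have := T.orderEmbOfFin_mem hm j
    simp only [hT, Finset.mem_union, Finset.mem_image, Finset.mem_univ, true_and] at this
    rcases this with ⟨i, hi⟩ | ⟨i, hi⟩
    · exact hi ▸ π.pt_mem i
    · exact hi ▸ π'.pt_mem i
  · intro i
    rw [Finset.range_orderEmbOfFin]
    simp [hT]
  · intro i
    rw [Finset.range_orderEmbOfFin]
    simp [hT]

/-- The filter of tagged partitions with mesh tending to zero. -/
noncomputable abbrev meshFilter (a b : ℝ) : Filter (TaggedPart a b) := comap TaggedPart.mesh (𝓝 0)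

theorem eventually_mesh_lt {δ : ℝ} (hδ : 0 < δ) : ∀ᶠ π in meshFilter a b, π.mesh < δ :=
  tendsto_comap.eventually_lt_const hδ

/-- Uniform partitions have arbitrarily small mesh. Nontriviality is what gives limits along this
filter any content. -/
theorem meshFilter_neBot (hab : a ≤ b) : (meshFilter a b).NeBot := by
  have hmesh : ∀ n : ℕ, ∃ π : TaggedPart a b, |π.mesh| ≤ (b - a) / (n + 1) := by
    intro n
    have hd : (0 : ℝ) < n + 1 := by positivity
    have hstep : 0 ≤ (b - a) / (n + 1) := div_nonneg (sub_nonneg.2 hab) hd.le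
    have hmono : Monotone fun i : Fin (n + 1 + 1) => a + (i : ℝ) * ((b - a) / (n + 1)) := by
      intro i j hij
      have : (i : ℝ) ≤ j := by exact_mod_cast hij
      simp only
      gcongr
    refine ⟨⟨n + 1, fun i => a + (i : ℝ) * ((b - a) / (n + 1)), hmono, by simp, ?_,
      fun i => a + (i : ℝ) * ((b - a) / (n + 1)), fun i => ⟨by simp, ?_⟩⟩, ?_⟩
    · simp only [Fin.val_last, Nat.cast_add, Nat.cast_one]
      field_simp
      ring
    · exact hmono (a := i.castSucc) (by simp [Fin.le_def])
    · simp only [TaggedPart.mesh, Fin.val_succ, Fin.val_castSucc, Nat.cast_add, Nat.cast_one]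
      have : ∀ i : Fin (n + 1), a + ((i : ℝ) + 1) * ((b - a) / (n + 1)) -
          (a + (i : ℝ) * ((b - a) / (n + 1))) = (b - a) / (n + 1) := fun i => by ring
      simp_rw [this, ciSup_const]
      rw [abs_of_nonneg hstep]
  rw [comap_neBot_iff]
  intro t ht
  obtain ⟨ε, hε, hball⟩ := Metric.mem_nhds_iff.1 ht
  obtain ⟨n, hn⟩ := exists_nat_gt ((b - a) / ε)
  obtain ⟨π, hπ⟩ := hmesh n
  refine ⟨π, hball ?_⟩
  rw [mem_ball_zero_iff, Real.norm_eq_abs]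
  refine hπ.trans_lt ?_
  rw [div_lt_iff₀ hε] at hn
  rw [div_lt_iff₀ (by positivity)]
  nlinarith

theorem tendsto_riemannSum (hab : a ≤ b) {φ : ℝ → ℝ} (hφ : ContinuousOn φ (Icc a b)) :
    Tendsto (fun π : TaggedPart a b =>
      ∑ i : Fin π.n, φ (π.tag i) * (π.pt i.succ - π.pt i.castSucc)) (meshFilter a b)
      (𝓝 (∫ x in a..b, φ x)) := by
  rw [Metric.tendsto_nhds]
  intro ε hε
  have huc := isCompact_Icc.uniformContinuousOn_of_continuous hφ
  -- The `+ 1` covers `a = b` and makes the final inequality strict.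
  obtain ⟨δ, hδ, hδφ⟩ := Metric.uniformContinuousOn_iff.1 huc (ε / (b - a + 1))
    (div_pos hε (by linarith))
  filter_upwards [eventually_mesh_lt hδ] with π hπ
  have hint : ∀ i j, IntervalIntegrable φ volume (π.pt i) (π.pt j) := fun i j =>
    (hφ.mono (uIcc_subset_Icc (π.pt_mem i) (π.pt_mem j))).intervalIntegrable
  have h1 : ∫ x in a..b, φ x = ∑ i : Fin π.n, ∫ x in (π.pt i.castSucc)..(π.pt i.succ), φ x := by
    have := sum_increments fun j => ∫ x in (π.pt 0)..(π.pt j), φ x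
    simp only [π.left, π.right, intervalIntegral.integral_same, sub_zero] at this
    rw [← this]
    refine Finset.sum_congr rfl fun i _ => ?_
    have h2 := hint 0 i.succ
    have h3 := hint 0 i.castSucc
    rw [π.left] at h2 h3
    exact intervalIntegral.integral_interval_sub_left h2 h3
  have h4 : ∀ i : Fin π.n, |φ (π.tag i) * (π.pt i.succ - π.pt i.castSucc) -
      ∫ x in (π.pt i.castSucc)..(π.pt i.succ), φ x| ≤
        ε / (b - a + 1) * (π.pt i.succ - π.pt i.castSucc) := by
    intro i
    have hle : π.pt i.castSucc ≤ π.pt i.succ := π.mono (by simp [Fin.le_def])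
    rw [mul_comm, ← smul_eq_mul, ← intervalIntegral.integral_const,
      ← intervalIntegral.integral_sub (by simp) (hint _ _), ← Real.norm_eq_abs]
    rw [← abs_of_nonneg (sub_nonneg.2 hle)]
    refine intervalIntegral.norm_integral_le_of_norm_le_const fun x hx => ?_
    rw [uIoc_of_le hle] at hx
    have htag := π.tag_mem i
    have hm := π.length_le_mesh i
    refine (hδφ _ (π.tag_mem_Icc i) x ⟨(π.pt_mem _).1.trans hx.1.le, hx.2.trans (π.pt_mem _).2⟩
      ?_).le
    rw [Real.dist_eq, abs_lt]
    constructor <;> linarith [hx.1, hx.2, htag.1, htag.2]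
  rw [h1, Real.dist_eq, ← Finset.sum_sub_distrib]
  calc _ ≤ ∑ i : Fin π.n, ε / (b - a + 1) * (π.pt i.succ - π.pt i.castSucc) :=
        (Finset.abs_sum_le_sum_abs _ _).trans (Finset.sum_le_sum fun i _ => h4 i)
    _ = ε / (b - a + 1) * (b - a) := by
        rw [← Finset.mul_sum, sum_increments, π.left, π.right]
    _ < ε := by
        rw [div_mul_eq_mul_div, div_lt_iff₀ (by linarith)]
        nlinarith

end StepFunctions

/-! ### Stochastic integrals: laws, existence, series -/

section Integral

variable {Ω : Type*} [MeasurableSpace Ω] {P : Measure Ω} {X : ℝ → Ω → ℝ} {α c a b : ℝ}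

/-- The increments of `X` have the stable laws of index `α` with scale `c` per unit time. -/
def HasStableIncrements (X : ℝ → Ω → ℝ) (α c : ℝ) (P : Measure Ω) : Prop :=
  (∀ t, AEMeasurable (X t) P) ∧ HasIndepIncrements X P ∧
    ∀ s t : ℝ, s ≤ t → ∀ u : ℝ, charFun (P.map (fun ω => X t ω - X s ω)) u =
      ((Real.exp (-(c * (t - s) * |u| ^ α)) : ℝ) : ℂ)

/-- Independence turns the characteristic function into a product, so the scales `c |w_j|^α (t_{j+1}
- t_j)` add. -/
theorem HasStableIncrements.sum (hX : HasStableIncrements X α c P) {m : ℕ}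
    {t : Fin (m + 1) → ℝ} (ht : Monotone t) (w : Fin m → ℝ) :
    HasStableLaw P α (c * ∑ j, |w j| ^ α * (t j.succ - t j.castSucc))
      (fun ω => ∑ j, w j * (X (t j.succ) ω - X (t j.castSucc) ω)) := by
  have hm : ∀ j : Fin m, AEMeasurable (fun ω => X (t j.succ) ω - X (t j.castSucc) ω) P :=
    fun j => (hX.1 _).sub (hX.1 _)
  have hmw : ∀ j : Fin m, AEMeasurable (fun ω => w j * (X (t j.succ) ω - X (t j.castSucc) ω)) P :=
    fun j => (hm j).const_mul _
  refine ⟨Finset.aemeasurable_fun_sum _ fun j _ => hmw j, fun u => ?_⟩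
  have hind : iIndepFun (fun (j : Fin m) ω => w j * (X (t j.succ) ω - X (t j.castSucc) ω)) P :=
    (hX.2.1 m t ht).comp (fun j x => w j * x) fun j => by fun_prop
  rw [hind.charFun_map_fun_sum_eq_prod hmw, Finset.prod_apply]
  have h1 : ∀ j : Fin m, charFun (P.map fun ω => w j * (X (t j.succ) ω - X (t j.castSucc) ω)) u =
      ((Real.exp (-(c * (t j.succ - t j.castSucc) * |w j * u| ^ α)) : ℝ) : ℂ) := by
    intro j
    rw [charFun_map_mul_comp (hm j), hX.2.2 _ _ (ht (by simp [Fin.le_def]))]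
  simp_rw [h1]
  rw [← Complex.ofReal_prod, ← Real.exp_sum]
  congr 2
  rw [Finset.sum_neg_distrib, Finset.mul_sum, Finset.sum_mul]
  congr 1
  refine Finset.sum_congr rfl fun j _ => ?_
  rw [abs_mul, Real.mul_rpow (abs_nonneg _) (abs_nonneg _)]
  ring

theorem HasStableIncrements.rsSum (hX : HasStableIncrements X α c P) (g : ℝ → ℝ)
    (π : TaggedPart a b) :
    HasStableLaw P α (c * ∑ i, |g (π.tag i)| ^ α * (π.pt i.succ - π.pt i.castSucc))
      (rsSum X g π) :=
  hX.sum π.mono fun i => g (π.tag i)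

/-- The scales of the Riemann–Stieltjes sums are `c` times Riemann sums of `|g|^α`. -/
theorem HasStableIncrements.isRSIntegral [IsProbabilityMeasure P] (hα : 0 ≤ α) (hab : a ≤ b)
    (hX : HasStableIncrements X α c P) {g : ℝ → ℝ} {J : Ω → ℝ} (hJ : IsRSIntegral P X a b g J) :
    HasStableLaw P α (c * ∫ x in a..b, |g x| ^ α) J := by
  have := meshFilter_neBot hab
  exact HasStableLaw.of_tendstoInMeasure (fun π => hX.rsSum g π)
    ((tendsto_riemannSum hab (hJ.1.abs.rpow_const fun _ _ => Or.inr hα)).const_mul c) hJ.2.2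

/-- On a common refinement the difference is a single weighted sum of independent increments, and
both step functions are within `ε` of `g`. The scale `κ` is fixed before `ε` and `δ`, so that it can
be chosen as a function of the pair of partitions. -/
theorem HasStableIncrements.exists_rsSum_sub (hX : HasStableIncrements X α c P) (hα : 0 ≤ α)
    (hc : 0 ≤ c) (g : ℝ → ℝ) (π π' : TaggedPart a b) :
    ∃ κ, 0 ≤ κ ∧
      HasStableLaw P α κ (fun ω => RandomJacobi.rsSum X g π ω - RandomJacobi.rsSum X g π' ω) ∧
      ∀ ε δ, 0 ≤ ε → (∀ x ∈ Icc a b, ∀ y ∈ Icc a b, |x - y| < δ → |g x - g y| ≤ ε) →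
        π.mesh < δ → π'.mesh < δ → κ ≤ c * ((2 * ε) ^ α * (b - a)) := by
  obtain ⟨m, t, ht, htm, hr, hr'⟩ := exists_common_refinement π π'
  have hnn : ∀ j : Fin m, 0 ≤ t j.succ - t j.castSucc :=
    fun j => sub_nonneg.2 (ht.monotone (by simp [Fin.le_def]))
  refine ⟨c * ∑ j : Fin m, |π.stepFun g (t j.castSucc) - π'.stepFun g (t j.castSucc)| ^ α *
    (t j.succ - t j.castSucc), ?_, ?_, fun ε δ hε hg hπ hπ' => ?_⟩
  · exact mul_nonneg hc (Finset.sum_nonneg fun j _ => mul_nonneg (by positivity) (hnn j))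
  · have h := hX.sum ht.monotone fun j =>
      π.stepFun g (t j.castSucc) - π'.stepFun g (t j.castSucc)
    convert h using 2 with ω
    rw [rsSum_eq_sum_stepFun X g π ht hr, rsSum_eq_sum_stepFun X g π' ht hr',
      ← Finset.sum_sub_distrib]
    exact Finset.sum_congr rfl fun j _ => by ring
  · gcongr
    calc _ ≤ ∑ j : Fin m, (2 * ε) ^ α * (t j.succ - t j.castSucc) := by
          refine Finset.sum_le_sum fun j _ => ?_
          have hx : t j.castSucc ∈ Ico a b :=
            ⟨(htm _).1, (ht (by simp [Fin.lt_def])).trans_le (htm j.succ).2⟩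
          obtain ⟨i, hi, hi'⟩ := π.exists_stepFun_eq g hx
          obtain ⟨k, hk, hk'⟩ := π'.exists_stepFun_eq g hx
          have h1 := hg _ (π.tag_mem_Icc i) _ (htm j.castSucc) (hi'.trans_lt hπ)
          have h2 := hg _ (π'.tag_mem_Icc k) _ (htm j.castSucc) (hk'.trans_lt hπ')
          rw [abs_sub_comm] at h2
          have h3 := abs_sub_le (g (π.tag i)) (g (t j.castSucc)) (g (π'.tag k))
          have := hnn j
          rw [hi, hk]
          gcongr
          linarith
      _ = (2 * ε) ^ α * (t (Fin.last m) - t 0) := by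
          rw [← Finset.mul_sum, sum_increments]
      _ ≤ (2 * ε) ^ α * (b - a) := by
          gcongr
          · exact (htm _).2
          · exact (htm _).1

/-- By uniform continuity the scale of the difference of two sums tends to `0` with both meshes, so
the sums are Cauchy in probability. -/
theorem HasStableIncrements.exists_isRSIntegral [IsProbabilityMeasure P] (hα : 0 < α) (hc : 0 ≤ c)
    (hab : a ≤ b) (hX : HasStableIncrements X α c P) {g : ℝ → ℝ} (hg : ContinuousOn g (Icc a b)) :
    ∃ J, IsRSIntegral P X a b g J := by
  have := meshFilter_neBot hab
  have huc := isCompact_Icc.uniformContinuousOn_of_continuous hg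
  choose κ hκ0 hκ hκb using fun q : TaggedPart a b × TaggedPart a b =>
    hX.exists_rsSum_sub hα.le hc g q.1 q.2
  have hlim : Tendsto κ (meshFilter a b ×ˢ meshFilter a b) (𝓝 0) := by
    have h0 : Tendsto (fun ε : ℝ => c * ((2 * ε) ^ α * (b - a))) (𝓝[>] 0) (𝓝 0) := by
      have hcont : Continuous fun ε : ℝ => c * ((2 * ε) ^ α * (b - a)) := by
        have : Continuous fun ε : ℝ => (2 * ε) ^ α :=
          (continuous_const.mul continuous_id).rpow_const fun _ => Or.inr hα.le
        fun_prop
      have := hcont.tendsto 0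
      simp only [mul_zero, Real.zero_rpow hα.ne', zero_mul] at this
      exact this.mono_left nhdsWithin_le_nhds
    rw [Metric.tendsto_nhds]
    intro e he
    obtain ⟨ε, hε, hεpos⟩ := ((h0.eventually_lt_const he).and self_mem_nhdsWithin).exists
    obtain ⟨δ, hδ, hδg⟩ := Metric.uniformContinuousOn_iff.1 huc ε hεpos
    filter_upwards [prod_mem_prod (eventually_mesh_lt hδ) (eventually_mesh_lt hδ)] with q hq
    rw [Real.dist_eq, sub_zero, abs_of_nonneg (hκ0 q)]
    exact (hκb q ε δ (le_of_lt hεpos) (fun x hx y hy hxy => (hδg x hx y hy hxy).le) hq.1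
      hq.2).trans_lt hε
  obtain ⟨J, hJ, hJt⟩ := exists_tendstoInMeasure_of_cauchy (fun π => (hX.rsSum g π).1)
    (tendstoInMeasure_zero_of_hasStableLaw hα.le (Eventually.of_forall hκ0)
      (Eventually.of_forall hκ) hlim)
  exact ⟨J, hg, hJ, hJt⟩

theorem IsRSIntegral.add_const_mul {g h : ℝ → ℝ} {I J : Ω → ℝ} (hI : IsRSIntegral P X a b g I)
    (hJ : IsRSIntegral P X a b h J) (r : ℝ) :
    IsRSIntegral P X a b (fun x => g x + r * h x) (fun ω => I ω + r * J ω) := by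
  refine ⟨hI.1.add (continuousOn_const.mul hJ.1), hI.2.1.add (hJ.2.1.const_mul r), ?_⟩
  convert TendstoInMeasure.add_real hI.2.2 (TendstoInMeasure.const_mul_real hJ.2.2 r) using 3
    with π ω
  simp only [rsSum, Finset.mul_sum, ← Finset.sum_add_distrib]
  exact Finset.sum_congr rfl fun i _ => by ring

theorem memLp_of_continuousOn {g : ℝ → ℝ} (hg : ContinuousOn g (Icc a b)) (p : ENNReal) :
    MemLp g p (volume.restrict (Icc a b)) := by
  obtain ⟨C, hC⟩ := isCompact_Icc.exists_bound_of_continuousOn hg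
  exact MemLp.of_bound (hg.aestronglyMeasurable measurableSet_Icc) C
    ((ae_restrict_iff' measurableSet_Icc).2 (ae_of_all _ hC))

/-- The law of a Riemann-Stieltjes integral in terms of the `L^α` norm of the integrand. -/
theorem HasStableIncrements.isRSIntegral_eLpNorm [IsProbabilityMeasure P] (hα : 0 < α)
    (hab : a ≤ b) (hX : HasStableIncrements X α c P) {g : ℝ → ℝ} {J : Ω → ℝ}
    (hJ : IsRSIntegral P X a b g J) :
    HasStableLaw P α
      (c * (eLpNorm g (ENNReal.ofReal α) (volume.restrict (Icc a b))).toReal ^ α) J := by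
  have h := hX.isRSIntegral hα.le hab hJ
  have h1 := (memLp_of_continuousOn hJ.1 (ENNReal.ofReal α)).eLpNorm_eq_integral_rpow_norm
    (by simpa using hα) (by simp)
  rw [ENNReal.toReal_ofReal hα.le] at h1
  have h2 : 0 ≤ ∫ x in Icc a b, ‖g x‖ ^ α := by positivity
  rw [h1, ENNReal.toReal_ofReal (by positivity), Real.rpow_inv_rpow h2 hα.ne',
    integral_Icc_eq_integral_Ioc, ← intervalIntegral.integral_of_le hab]
  exact h

theorem IsStochIntegral.add_const_mul (hα : 1 ≤ α) {g h : ℝ → ℝ} {I J : Ω → ℝ}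
    (hI : IsStochIntegral P X α a b g I) (hJ : IsStochIntegral P X α a b h J) (r : ℝ) :
    IsStochIntegral P X α a b (fun x => g x + r * h x) (fun ω => I ω + r * J ω) := by
  obtain ⟨hg, hIm, gk, Ik, hIk, hgk, hIt⟩ := hI
  obtain ⟨hh, hJm, hk, Jk, hJk, hhk, hJt⟩ := hJ
  refine ⟨hg.add (hh.const_mul r), hIm.add (hJm.const_mul r), fun k x => gk k x + r * hk k x,
    fun k ω => Ik k ω + r * Jk k ω, fun k => (hIk k).add_const_mul (hJk k) r, ?_,
    TendstoInMeasure.add_real hIt (TendstoInMeasure.const_mul_real hJt r)⟩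
  have h0 := hgk.add (ENNReal.Tendsto.const_mul (a := ‖r‖ₑ) hhk (Or.inr enorm_ne_top))
  rw [mul_zero, add_zero] at h0
  refine tendsto_of_tendsto_of_tendsto_of_le_of_le tendsto_const_nhds h0 (fun _ => zero_le)
    fun k => ?_
  have e : (fun t => gk k t + r * hk k t - (g t + r * h t)) =
      (fun t => gk k t - g t) + r • fun t => hk k t - h t := by
    ext t; simp; ring
  have m1 := (memLp_of_continuousOn (hIk k).1 (ENNReal.ofReal α)).sub hg
  have m2 := (memLp_of_continuousOn (hJk k).1 (ENNReal.ofReal α)).sub hh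
  simp only [e]
  refine (eLpNorm_add_le m1.1 (m2.1.const_smul r) (by simpa using hα)).trans ?_
  exact add_le_add le_rfl (eLpNorm_const_smul _ _ _ _).le

/-- The law of a stochastic integral. -/
theorem HasStableIncrements.isStochIntegral [IsProbabilityMeasure P] (hα : 1 ≤ α)
    (hab : a ≤ b) (hX : HasStableIncrements X α c P) {h : ℝ → ℝ} {I : Ω → ℝ}
    (hI : IsStochIntegral P X α a b h I) :
    HasStableLaw P α
      (c * (eLpNorm h (ENNReal.ofReal α) (volume.restrict (Icc a b))).toReal ^ α) I := by
  obtain ⟨hh, hIm, gk, Jk, hJk, hgk, hJt⟩ := hI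
  have hα0 : 0 < α := by linarith
  have : Fact (1 ≤ ENNReal.ofReal α) := ⟨by simpa using hα⟩
  refine HasStableLaw.of_tendstoInMeasure (fun k => hX.isRSIntegral_eLpNorm hα0 hab (hJk k)) ?_ hJt
  have h1 := ((Lp.tendsto_Lp_iff_tendsto_eLpNorm'' gk
    (fun k => memLp_of_continuousOn (hJk k).1 (ENNReal.ofReal α)) h hh).2 hgk).norm
  simp only [Lp.norm_toLp] at h1
  exact (h1.rpow_const (Or.inr hα0.le)).const_mul c

/-- Continuous functions are dense in `L^α`. The integrals of an approximating sequence are Cauchy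
in probability, since their differences have scales given by `L^α` distances. -/
theorem HasStableIncrements.exists_isStochIntegral [IsProbabilityMeasure P] (hα : 1 ≤ α)
    (hc : 0 ≤ c) (hab : a ≤ b) (hX : HasStableIncrements X α c P) {h : ℝ → ℝ}
    (hh : MemLp h (ENNReal.ofReal α) (volume.restrict (Icc a b))) :
    ∃ I, IsStochIntegral P X α a b h I := by
  have hα0 : 0 < α := by linarith
  have hα1 : 1 ≤ ENNReal.ofReal α := by simpa using hα
  have : Fact (1 ≤ ENNReal.ofReal α) := ⟨hα1⟩
  obtain ⟨e, -, he0, he⟩ := exists_seq_strictAnti_tendsto' (show (0 : ENNReal) < 1 by simp)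
  choose g hg hgm using fun k => hh.exists_boundedContinuous_eLpNorm_sub_le (by simp)
    (he0 k).1.ne'
  choose J hJ using fun k =>
    hX.exists_isRSIntegral hα0 hc hab (g := g k) (g k).continuous.continuousOn
  have hgk : Tendsto (fun k => eLpNorm (fun t => g k t - h t) (ENNReal.ofReal α)
      (volume.restrict (Icc a b))) atTop (𝓝 0) := by
    refine tendsto_of_tendsto_of_tendsto_of_le_of_le tendsto_const_nhds he (fun _ => zero_le)
      fun k => ?_
    have := hg k
    rwa [eLpNorm_sub_comm] at this
  have hlim := (Lp.tendsto_Lp_iff_tendsto_eLpNorm'' (fun k => ⇑(g k)) hgm h hh).2 hgk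
  have hdist : Tendsto (fun q : ℕ × ℕ => c *
      (eLpNorm (fun t => g q.1 t + -1 * g q.2 t) (ENNReal.ofReal α)
        (volume.restrict (Icc a b))).toReal ^ α) (atTop ×ˢ atTop) (𝓝 0) := by
    have h1 := ((hlim.comp (tendsto_fst (f := atTop) (g := atTop))).sub
      (hlim.comp (tendsto_snd (f := atTop) (g := atTop)))).norm
    have h2 : ∀ q : ℕ × ℕ, ‖((hgm q.1).toLp _) - (hgm q.2).toLp _‖ =
        (eLpNorm (fun t => g q.1 t + -1 * g q.2 t) (ENNReal.ofReal α)
          (volume.restrict (Icc a b))).toReal := by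
      intro q
      rw [← MemLp.toLp_sub, Lp.norm_toLp]
      congr 2
      ext t
      simp [sub_eq_add_neg]
    simp only [Function.comp_apply, h2, sub_self, norm_zero] at h1
    have h3 := (h1.rpow_const (p := α) (Or.inr hα0.le)).const_mul c
    rwa [Real.zero_rpow hα0.ne', mul_zero] at h3
  have hcauchy := tendstoInMeasure_zero_of_hasStableLaw hα0.le
    (Eventually.of_forall fun q => by positivity)
    (Eventually.of_forall fun q : ℕ × ℕ => hX.isRSIntegral_eLpNorm hα0 hab
      ((hJ q.1).add_const_mul (hJ q.2) (-1))) hdist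
  obtain ⟨I, hI, hIt⟩ := exists_tendstoInMeasure_of_cauchy (fun k => (hJ k).2.1) (l := atTop)
    (by simpa [sub_eq_add_neg] using hcauchy)
  exact ⟨I, hh, hI, fun k => g k, J, hJ, hgk, hIt⟩

/-- Finite linear combinations of stochastic integrals. -/
theorem IsStochIntegral.sub_sum (hα : 1 ≤ α) {h : ℝ → ℝ} {I : Ω → ℝ}
    (hI : IsStochIntegral P X α a b h I) {g : ℕ → ℝ → ℝ} {B : ℕ → Ω → ℝ}
    (hB : ∀ k, IsStochIntegral P X α a b (g k) (B k)) (r : ℕ → ℝ) (n : ℕ) :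
    IsStochIntegral P X α a b (fun x => h x - ∑ k ∈ Finset.range n, r k * g k x)
      (fun ω => I ω - ∑ k ∈ Finset.range n, r k * B k ω) := by
  induction n with
  | zero => simpa using hI
  | succ n ih =>
    have := ih.add_const_mul hα (hB n) (-r n)
    simp only [Finset.sum_range_succ, ← sub_sub]
    simpa [sub_eq_add_neg] using this

/-- If a series converges in `L^α`, then the series of the stochastic integrals converges in
probability to the stochastic integral of the sum. -/
theorem HasStableIncrements.tendstoInMeasure_sum [IsProbabilityMeasure P] (hα : 1 ≤ α)
    (hc : 0 ≤ c) (hab : a ≤ b) (hX : HasStableIncrements X α c P) {h : ℝ → ℝ} {I : Ω → ℝ}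
    (hI : IsStochIntegral P X α a b h I) {g : ℕ → ℝ → ℝ} {B : ℕ → Ω → ℝ}
    (hB : ∀ k, IsStochIntegral P X α a b (g k) (B k)) (r : ℕ → ℝ)
    (hlim : Tendsto (fun n => eLpNorm (fun x => h x - ∑ k ∈ Finset.range n, r k * g k x)
      (ENNReal.ofReal α) (volume.restrict (Icc a b))) atTop (𝓝 0)) :
    TendstoInMeasure P (fun (n : ℕ) ω => ∑ k ∈ Finset.range n, r k * B k ω) atTop I := by
  have hα0 : 0 < α := by linarith
  -- By linearity this is the scale of the law of `I` minus its `n`-th partial sum.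
  have h1 : Tendsto (fun n => c * (eLpNorm (fun x => h x - ∑ k ∈ Finset.range n, r k * g k x)
      (ENNReal.ofReal α) (volume.restrict (Icc a b))).toReal ^ α) atTop (𝓝 0) := by
    have := (((ENNReal.tendsto_toReal ENNReal.zero_ne_top).comp hlim).rpow_const
      (p := α) (Or.inr hα0.le)).const_mul c
    simpa [Real.zero_rpow hα0.ne'] using this
  refine tendstoInMeasure_zero_of_le (tendstoInMeasure_zero_of_hasStableLaw hα0.le
    (Eventually.of_forall fun n => by positivity)
    (Eventually.of_forall fun n => hX.isStochIntegral hα hab (hI.sub_sum hα hB r n)) h1) 1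
    fun n ω => ?_
  rw [one_mul, abs_sub_comm]

end Integral

/-! ### Closed form of the Jacobi polynomials and pointwise bounds -/

section JacobiFormula

theorem ringChoose_succ_mul (a : ℝ) (k : ℕ) :
    Ring.choose a (k + 1) * (k + 1) = Ring.choose a k * (a - k) := by
  have h := Ring.choose_smul_choose a (Nat.le_add_right k 1)
  simp only [Nat.choose_succ_self_right, add_tsub_cancel_left, Ring.choose_one_right, nsmul_eq_mul,
    Nat.cast_add, Nat.cast_one] at h
  rw [← h, mul_comm]

theorem ringChoose_succ_succ_mul (a : ℝ) (k : ℕ) :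
    Ring.choose (a + 1) (k + 1) * (k + 1) = (a + 1) * Ring.choose a k := by
  have h := Ring.choose_smul_choose (a + 1) (Nat.le_add_left 1 k)
  simp only [Nat.choose_one_right, add_tsub_cancel_right, Ring.choose_one_right, nsmul_eq_mul,
    Nat.cast_add, Nat.cast_one] at h
  rw [← h, mul_comm]

/-- With `n = m + s + 1`, passing from `s` to `s + 1` multiplies both sides by `(2m + 2)(2m + 1) /
((2s + 3)(2s + 2))`. Thus the coefficients of the Jacobi polynomial are proportional to odd
binomials. -/
theorem ringChoose_half_mul (n s : ℕ) (hs : s ≤ n) :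
    Ring.choose ((n : ℝ) + 1 / 2) (n - s) * Ring.choose ((n : ℝ) + -1 / 2) s * (2 * n + 1) =
      Ring.choose ((n : ℝ) + 1 / 2) n * ((2 * n + 1).choose (2 * s + 1) : ℝ) := by
  induction s with
  | zero => simp
  | succ s ih =>
    obtain ⟨m, rfl⟩ : ∃ m, n = m + s + 1 := ⟨n - s - 1, by omega⟩
    have ih := ih (by omega)
    rw [show m + s + 1 - s = m + 1 by omega] at ih
    rw [show m + s + 1 - (s + 1) = m by omega]
    have h1 := ringChoose_succ_mul (((m + s + 1 : ℕ) : ℝ) + 1 / 2) m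
    have h2 := ringChoose_succ_mul (((m + s + 1 : ℕ) : ℝ) + -1 / 2) s
    have h3 := Nat.choose_succ_right_eq (2 * (m + s + 1) + 1) (2 * s + 1)
    have h4 := Nat.choose_succ_right_eq (2 * (m + s + 1) + 1) (2 * s + 2)
    rw [show 2 * (m + s + 1) + 1 - (2 * s + 1) = 2 * m + 2 by omega] at h3
    rw [show 2 * (m + s + 1) + 1 - (2 * s + 2) = 2 * m + 1 by omega] at h4
    have h3' : (((2 * (m + s + 1) + 1).choose (2 * s + 1 + 1) : ℕ) : ℝ) * (2 * s + 1 + 1) =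
        ((2 * (m + s + 1) + 1).choose (2 * s + 1) : ℕ) * (2 * m + 2) := by exact_mod_cast h3
    have h4' : (((2 * (m + s + 1) + 1).choose (2 * s + 2 + 1) : ℕ) : ℝ) * (2 * s + 2 + 1) =
        ((2 * (m + s + 1) + 1).choose (2 * s + 2) : ℕ) * (2 * m + 1) := by exact_mod_cast h4
    rw [show 2 * (s + 1) + 1 = 2 * s + 2 + 1 by ring]
    push_cast at *
    set A := Ring.choose ((m : ℝ) + s + 1 + 1 / 2) m
    set A' := Ring.choose ((m : ℝ) + s + 1 + 1 / 2) (m + 1)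
    set D := Ring.choose ((m : ℝ) + s + 1 + -1 / 2) s
    set D' := Ring.choose ((m : ℝ) + s + 1 + -1 / 2) (s + 1)
    set q := Ring.choose ((m : ℝ) + s + 1 + 1 / 2) (m + s + 1)
    set c1 : ℝ := (((2 * (m + s + 1) + 1).choose (2 * s + 1) : ℕ) : ℝ)
    set c2 : ℝ := (((2 * (m + s + 1) + 1).choose (2 * s + 2) : ℕ) : ℝ)
    set c3 : ℝ := (((2 * (m + s + 1) + 1).choose (2 * s + 2 + 1) : ℕ) : ℝ)
    have e1 : A * (s + 3 / 2) = A' * (m + 1) := by rw [h1]; ring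
    have e2 : D' * (s + 1) = D * (m + 1 / 2) := by rw [h2]; ring
    have e3 : c3 * ((2 * s + 3) * (2 * s + 2)) = c1 * ((2 * m + 2) * (2 * m + 1)) := by
      have h3'' : c2 * (2 * s + 2) = c1 * (2 * m + 2) := by rw [← h3']; ring
      calc _ = c3 * (2 * s + 2 + 1) * (2 * s + 2) := by ring
        _ = c2 * (2 * s + 2) * (2 * m + 1) := by rw [h4']; ring
        _ = _ := by rw [h3'']; ring
    have hpos : ((s : ℝ) + 3 / 2) * (s + 1) ≠ 0 := by positivity
    apply mul_right_cancel₀ hpos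
    calc _ = (A * (s + 3 / 2)) * (D' * (s + 1)) * (2 * (m + s + 1) + 1) := by ring
      _ = (A' * D * (2 * (m + s + 1) + 1)) * ((m + 1) * (m + 1 / 2)) := by rw [e1, e2]; ring
      _ = q * (c1 * ((2 * m + 2) * (2 * m + 1))) / 4 := by rw [ih]; ring
      _ = _ := by rw [← e3]; ring

theorem sum_range_two_mul {M : Type*} [AddCommMonoid M] (f : ℕ → M) (n : ℕ) :
    ∑ k ∈ Finset.range (2 * n), f k = ∑ s ∈ Finset.range n, (f (2 * s) + f (2 * s + 1)) := by
  induction n with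
  | zero => simp
  | succ n ih =>
    rw [show 2 * (n + 1) = 2 * n + 1 + 1 by ring, Finset.sum_range_succ, Finset.sum_range_succ, ih,
      Finset.sum_range_succ, add_assoc]

/-- Imaginary part of de Moivre's formula: even powers of `i sin φ` are real and drop out. -/
theorem sin_odd_mul (n : ℕ) (φ : ℝ) :
    Real.sin ((2 * n + 1) * φ) = ∑ s ∈ Finset.range (n + 1),
      ((2 * n + 1).choose (2 * s + 1) : ℝ) * (-Real.sin φ ^ 2) ^ s * (Real.cos φ ^ 2) ^ (n - s) *
        Real.sin φ := by
  have h := Complex.cos_add_sin_mul_I_pow (2 * n + 1) (φ : ℂ)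
  have h1 := congrArg Complex.im h
  have e : Complex.cos (((2 * n + 1 : ℕ) : ℂ) * φ) + Complex.sin (((2 * n + 1 : ℕ) : ℂ) * φ) * Complex.I
      = (Real.cos ((2 * n + 1) * φ) : ℂ) + (Real.sin ((2 * n + 1) * φ) : ℂ) * Complex.I := by
    push_cast; rfl
  rw [e, add_comm (Complex.cos (φ : ℂ)), add_pow, show 2 * n + 1 + 1 = 2 * (n + 1) by ring,
    sum_range_two_mul, Complex.im_sum] at h1
  have e2 : ((Real.cos ((2 * n + 1) * φ) : ℂ) + (Real.sin ((2 * n + 1) * φ) : ℂ) * Complex.I).im =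
      Real.sin ((2 * n + 1) * φ) := by
    rw [Complex.add_im, Complex.ofReal_im, Complex.im_ofReal_mul, Complex.I_im, mul_one, zero_add]
  rw [← e2, ← h1]
  refine Finset.sum_congr rfl fun s hs => ?_
  have hs : s ≤ n := by simpa [Nat.lt_succ_iff] using hs
  have f1 : (Complex.sin φ * Complex.I) ^ (2 * s) * Complex.cos φ ^ (2 * n + 1 - 2 * s) *
      ((2 * n + 1).choose (2 * s) : ℂ) = (((-Real.sin φ ^ 2) ^ s *
        Real.cos φ ^ (2 * n + 1 - 2 * s) * ((2 * n + 1).choose (2 * s) : ℝ) : ℝ) : ℂ) := by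
    rw [pow_mul, mul_pow, Complex.I_sq]; push_cast; ring
  have f2 : (Complex.sin φ * Complex.I) ^ (2 * s + 1) * Complex.cos φ ^ (2 * n + 1 - (2 * s + 1)) *
      ((2 * n + 1).choose (2 * s + 1) : ℂ) = ((((2 * n + 1).choose (2 * s + 1) : ℝ) *
        (-Real.sin φ ^ 2) ^ s * (Real.cos φ ^ 2) ^ (n - s) * Real.sin φ : ℝ) : ℂ) * Complex.I := by
    rw [pow_succ (Complex.sin φ * Complex.I), pow_mul (Complex.sin φ * Complex.I), mul_pow,
      Complex.I_sq, show 2 * n + 1 - (2 * s + 1) = 2 * (n - s) by omega, pow_mul]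
    push_cast; ring
  rw [f1, f2, Complex.add_im, Complex.ofReal_im, zero_add, Complex.im_ofReal_mul, Complex.I_im, mul_one]

/-- At `x = cos θ` one has `(x - 1)/2 = -sin²(θ/2)` and `(x + 1)/2 = cos²(θ/2)`, and the defining
sum becomes the de Moivre expansion at `θ/2`. -/
theorem jacobiP_half_cos (n : ℕ) (θ : ℝ) :
    jacobiP (1 / 2) (-1 / 2) n (Real.cos θ) * (2 * n + 1) * Real.sin (θ / 2) =
      Ring.choose ((n : ℝ) + 1 / 2) n * Real.sin ((n + 1 / 2) * θ) := by
  rw [show ((n : ℝ) + 1 / 2) * θ = (2 * n + 1) * (θ / 2) by ring, sin_odd_mul, jacobiP,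
    Finset.sum_mul, Finset.sum_mul, Finset.mul_sum]
  refine Finset.sum_congr rfl fun s hs => ?_
  have hs : s ≤ n := by simpa [Nat.lt_succ_iff] using hs
  have h := Real.cos_sq' (θ / 2)
  have h' := Real.cos_two_mul (θ / 2)
  rw [show 2 * (θ / 2) = θ by ring] at h'
  rw [show (Real.cos θ - 1) / 2 = -Real.sin (θ / 2) ^ 2 by linarith,
    show (Real.cos θ + 1) / 2 = Real.cos (θ / 2) ^ 2 by linarith]
  calc _ = (Ring.choose ((n : ℝ) + 1 / 2) (n - s) * Ring.choose ((n : ℝ) + -1 / 2) s *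
        (2 * n + 1)) * (-Real.sin (θ / 2) ^ 2) ^ s * (Real.cos (θ / 2) ^ 2) ^ (n - s) *
          Real.sin (θ / 2) := by ring
    _ = _ := by rw [ringChoose_half_mul n s hs]; ring

/-- This makes the normalizing factor `n! / Γ(n + 1/2)` of `u_n` collapse to the constant `1/√π`. -/
theorem ringChoose_half_self (n : ℕ) :
    Ring.choose ((n : ℝ) + 1 / 2) n * n.factorial * √Real.pi =
      (2 * n + 1) * Real.Gamma (n + 1 / 2) := by
  induction n with
  | zero => simpa using Real.Gamma_one_half_eq.symm
  | succ n ih =>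
    have h := ringChoose_succ_succ_mul ((n : ℝ) + 1 / 2) n
    have hG := Real.Gamma_add_one (s := (n : ℝ) + 1 / 2) (by positivity)
    rw [Nat.factorial_succ]
    push_cast
    rw [show (n : ℝ) + 1 + 1 / 2 = n + 1 / 2 + 1 by ring, hG]
    calc _ = (Ring.choose ((n : ℝ) + 1 / 2 + 1) (n + 1) * (n + 1)) * n.factorial * √Real.pi := by
          ring
      _ = (n + 1 / 2 + 1) * (Ring.choose ((n : ℝ) + 1 / 2) n * n.factorial * √Real.pi) := by
          rw [h]; ring
      _ = _ := by rw [ih]; ring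

/-- `u_n(cos θ) sin(θ/2) = sin((n + 1/2) θ) / √π`. -/
theorem jacobiU_cos (n : ℕ) (θ : ℝ) :
    jacobiU n (Real.cos θ) * Real.sin (θ / 2) = (√Real.pi)⁻¹ * Real.sin ((n + 1 / 2) * θ) := by
  have hP := jacobiP_half_cos n θ
  have hq := ringChoose_half_self n
  have hπ : 0 < √Real.pi := Real.sqrt_pos.2 Real.pi_pos
  have hG : 0 < Real.Gamma ((n : ℝ) + 1 / 2) := Real.Gamma_pos_of_pos (by positivity)
  have hG1 : Real.Gamma ((n : ℝ) + 3 / 2) = (n + 1 / 2) * Real.Gamma ((n : ℝ) + 1 / 2) := by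
    rw [← Real.Gamma_add_one (by positivity)]; ring_nf
  have hN : √((2 * (n : ℝ) + 1) * Real.Gamma ((n : ℝ) + 1) * Real.Gamma ((n : ℝ) + 1) /
      (2 * Real.Gamma ((n : ℝ) + 3 / 2) * Real.Gamma ((n : ℝ) + 1 / 2))) =
      n.factorial / Real.Gamma ((n : ℝ) + 1 / 2) := by
    rw [hG1, Real.Gamma_nat_eq_factorial, Real.sqrt_eq_iff_mul_self_eq (by positivity) (by positivity)]
    field_simp
  rw [jacobiU, hN]
  have hd : (2 * (n : ℝ) + 1) ≠ 0 := by positivity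
  apply mul_right_cancel₀ hd
  calc _ = n.factorial / Real.Gamma ((n : ℝ) + 1 / 2) *
        (jacobiP (1 / 2) (-1 / 2) n (Real.cos θ) * (2 * n + 1) * Real.sin (θ / 2)) := by ring
    _ = (Ring.choose ((n : ℝ) + 1 / 2) n * n.factorial * √Real.pi) / Real.Gamma ((n : ℝ) + 1 / 2) *
        (√Real.pi)⁻¹ * Real.sin ((n + 1 / 2) * θ) := by rw [hP]; field_simp
    _ = _ := by rw [hq]; field_simp

theorem continuous_jacobiU (n : ℕ) : Continuous (jacobiU n) := by
  unfold jacobiU jacobiP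
  fun_prop

theorem abs_sin_nat_mul_le (n : ℕ) (φ : ℝ) : |Real.sin (n * φ)| ≤ n * |Real.sin φ| := by
  induction n with
  | zero => simp
  | succ n ih =>
    push_cast
    rw [add_mul, one_mul, Real.sin_add]
    calc _ ≤ |Real.sin (n * φ)| * |Real.cos φ| + |Real.cos (n * φ)| * |Real.sin φ| := by
          rw [← abs_mul, ← abs_mul]; exact abs_add_le _ _
      _ ≤ n * |Real.sin φ| * 1 + 1 * |Real.sin φ| := by
          gcongr
          · exact Real.abs_cos_le_one _
          · exact Real.abs_cos_le_one _
      _ = _ := by ring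

theorem inv_sqrt_pi_le_one : (√Real.pi)⁻¹ ≤ 1 :=
  inv_le_one_of_one_le₀ (Real.one_le_sqrt.2 (by linarith [Real.pi_gt_three]))

theorem sin_half_arccos {t : ℝ} (ht : t ∈ Icc (-1 : ℝ) 1) :
    Real.sin (Real.arccos t / 2) = √((1 - t) / 2) := by
  rw [Real.sin_half_eq_sqrt (Real.arccos_nonneg t)
    (by linarith [Real.arccos_le_pi t, Real.pi_pos]), Real.cos_arccos ht.1 ht.2]

theorem abs_jacobiU_mul_sqrt_le (n : ℕ) {t : ℝ} (ht : t ∈ Icc (-1 : ℝ) 1) :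
    |jacobiU n t| * √((1 - t) / 2) ≤ 1 := by
  have h := jacobiU_cos n (Real.arccos t)
  rw [Real.cos_arccos ht.1 ht.2, sin_half_arccos ht] at h
  have h2 := congrArg abs h
  rw [abs_mul, abs_mul, abs_of_nonneg (Real.sqrt_nonneg ((1 - t) / 2)),
    abs_of_pos (inv_pos.2 (Real.sqrt_pos.2 Real.pi_pos))] at h2
  rw [h2]
  exact mul_le_one₀ inv_sqrt_pi_le_one (abs_nonneg _) (Real.abs_sin_le_one _)

theorem abs_jacobiU_le (n : ℕ) {t : ℝ} (ht : t ∈ Icc (-1 : ℝ) 1) :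
    |jacobiU n t| ≤ 2 * n + 1 := by
  -- The quotient formula fails at `t = 1`, where `sin(θ/2) = 0`; that point is recovered by
  -- continuity.
  have hcl : IsClosed {t : ℝ | |jacobiU n t| ≤ 2 * n + 1} :=
    isClosed_le (continuous_jacobiU n).abs continuous_const
  have hsub : Ico (-1 : ℝ) 1 ⊆ {t : ℝ | |jacobiU n t| ≤ 2 * n + 1} := by
    intro x hx
    have hx' : x ∈ Icc (-1 : ℝ) 1 := ⟨hx.1, hx.2.le⟩
    have h := jacobiU_cos n (Real.arccos x)
    rw [Real.cos_arccos hx'.1 hx'.2] at h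
    have hpos : 0 < Real.sin (Real.arccos x / 2) := by
      rw [sin_half_arccos hx']
      exact Real.sqrt_pos.2 (by linarith [hx.2])
    have h3 := abs_sin_nat_mul_le (2 * n + 1) (Real.arccos x / 2)
    push_cast at h3
    rw [show (2 * (n : ℝ) + 1) * (Real.arccos x / 2) = (n + 1 / 2) * Real.arccos x by ring,
      abs_of_pos hpos] at h3
    have h2 := congrArg abs h
    rw [abs_mul, abs_mul, abs_of_pos hpos, abs_of_pos (inv_pos.2 (Real.sqrt_pos.2 Real.pi_pos))] at h2
    refine le_of_mul_le_mul_right ?_ hpos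
    rw [h2]
    exact (mul_le_of_le_one_left (abs_nonneg _) inv_sqrt_pi_le_one).trans h3
  have := closure_minimal hsub hcl
  rw [closure_Ico (by norm_num)] at this
  exact this ht

/-- Geometric mean of the two bounds with weights `1/4` and `3/4`. A weight `s` on the second must
satisfy `s < 1` for square integrability and `s > 1/2` for summability against `n^(-5/2)`; `3/4` is
the midpoint. -/
theorem abs_jacobiU_le_rpow (n : ℕ) {t : ℝ} (ht : t ∈ Ico (-1 : ℝ) 1) :
    |jacobiU n t| ≤ (2 * n + 1) ^ (1 / 4 : ℝ) * (2 * (1 - t) ^ (-(3 / 8) : ℝ)) := by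
  have ht' : t ∈ Icc (-1 : ℝ) 1 := ⟨ht.1, ht.2.le⟩
  have hpos : 0 < (1 - t) / 2 := by linarith [ht.2]
  have h1 := abs_jacobiU_le n ht'
  have h2 : |jacobiU n t| ≤ ((1 - t) / 2) ^ (-(1 / 2) : ℝ) := by
    rw [Real.rpow_neg hpos.le, ← Real.sqrt_eq_rpow, ← one_div, le_div_iff₀ (Real.sqrt_pos.2 hpos)]
    exact abs_jacobiU_mul_sqrt_le n ht'
  have h3 : ((1 - t) / 2) ^ (-(3 / 8) : ℝ) ≤ 2 * (1 - t) ^ (-(3 / 8) : ℝ) := by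
    rw [Real.div_rpow (by linarith [ht.2]) (by norm_num), div_eq_mul_inv, mul_comm,
      ← Real.rpow_neg (by norm_num), neg_neg]
    gcongr
    · exact Real.rpow_nonneg (by linarith [ht.2]) _
    · exact (Real.rpow_le_rpow_of_exponent_le (by norm_num)
        (by norm_num : (3 / 8 : ℝ) ≤ 1)).trans_eq (Real.rpow_one 2)
  calc |jacobiU n t| = |jacobiU n t| ^ (1 / 4 : ℝ) * |jacobiU n t| ^ (3 / 4 : ℝ) := by
        rw [← Real.rpow_add_of_nonneg (abs_nonneg _) (by norm_num) (by norm_num)]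
        norm_num
    _ ≤ (2 * n + 1) ^ (1 / 4 : ℝ) * (((1 - t) / 2) ^ (-(1 / 2) : ℝ)) ^ (3 / 4 : ℝ) := by gcongr
    _ = (2 * n + 1) ^ (1 / 4 : ℝ) * ((1 - t) / 2) ^ (-(3 / 8) : ℝ) := by
        rw [← Real.rpow_mul hpos.le]; norm_num
    _ ≤ _ := by gcongr

end JacobiFormula

/-! ### Decay of the Fourier–Jacobi coefficients -/

section Decay

/-- Bounded functions on the line which satisfy a Hölder condition of order `1/2`. -/
def BddHolderHalf (φ : ℝ → ℝ) : Prop :=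
  ∃ K : ℝ, 0 ≤ K ∧ (∀ x, |φ x| ≤ K) ∧ ∀ x y, |φ x - φ y| ≤ K * |x - y| ^ (1 / 2 : ℝ)

theorem BddHolderHalf.mul {φ ψ : ℝ → ℝ} (hφ : BddHolderHalf φ) (hψ : BddHolderHalf ψ) :
    BddHolderHalf fun x => φ x * ψ x := by
  obtain ⟨K, hK, hb, hh⟩ := hφ
  obtain ⟨L, hL, hb', hh'⟩ := hψ
  refine ⟨2 * (K * L), by positivity, fun x => ?_, fun x y => ?_⟩
  · rw [abs_mul]
    have : |φ x| * |ψ x| ≤ K * L := mul_le_mul (hb x) (hb' x) (abs_nonneg _) hK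
    nlinarith [mul_nonneg hK hL]
  · calc |φ x * ψ x - φ y * ψ y| = |φ x * (ψ x - ψ y) + (φ x - φ y) * ψ y| := by ring_nf
      _ ≤ |φ x| * |ψ x - ψ y| + |φ x - φ y| * |ψ y| := by
          rw [← abs_mul, ← abs_mul]; exact abs_add_le _ _
      _ ≤ K * (L * |x - y| ^ (1 / 2 : ℝ)) + K * |x - y| ^ (1 / 2 : ℝ) * L := by
          gcongr
          · exact hb x
          · exact hh' x y
          · exact hh x y
          · exact hb' y
      _ = _ := by ring

theorem BddHolderHalf.sub {φ ψ : ℝ → ℝ} (hφ : BddHolderHalf φ) (hψ : BddHolderHalf ψ) :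
    BddHolderHalf fun x => φ x - ψ x := by
  obtain ⟨K, hK, hb, hh⟩ := hφ
  obtain ⟨L, hL, hb', hh'⟩ := hψ
  refine ⟨K + L, by positivity, fun x => ?_, fun x y => ?_⟩
  · exact (abs_sub _ _).trans (add_le_add (hb x) (hb' x))
  · calc |φ x - ψ x - (φ y - ψ y)| = |(φ x - φ y) - (ψ x - ψ y)| := by ring_nf
      _ ≤ |φ x - φ y| + |ψ x - ψ y| := abs_sub _ _
      _ ≤ K * |x - y| ^ (1 / 2 : ℝ) + L * |x - y| ^ (1 / 2 : ℝ) := add_le_add (hh x y) (hh' x y)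
      _ = _ := by ring

theorem le_two_mul_rpow_half {d M : ℝ} (hd : 0 ≤ d) (hM : M ≤ 2) (hMd : M ≤ d) :
    M ≤ 2 * d ^ (1 / 2 : ℝ) := by
  rw [← Real.sqrt_eq_rpow]
  rcases le_total d 4 with h | h
  · have h1 := Real.sq_sqrt hd
    have h2 : √d ≤ 2 := Real.sqrt_le_iff.2 ⟨by norm_num, by linarith⟩
    nlinarith [Real.sqrt_nonneg d]
  · have : 2 ≤ √d := Real.le_sqrt_of_sq_le (by linarith)
    linarith

theorem bddHolderHalf_of_lipschitz {φ : ℝ → ℝ} (hb : ∀ x, |φ x| ≤ 1)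
    (hl : ∀ x y, |φ x - φ y| ≤ |x - y|) : BddHolderHalf φ :=
  ⟨2, by norm_num, fun x => (hb x).trans (by norm_num), fun x y =>
    le_two_mul_rpow_half (abs_nonneg _)
      ((abs_sub _ _).trans (by linarith [hb x, hb y])) (hl x y)⟩

theorem bddHolderHalf_cos : BddHolderHalf Real.cos :=
  bddHolderHalf_of_lipschitz Real.abs_cos_le_one Real.abs_cos_sub_cos_le

theorem bddHolderHalf_sin : BddHolderHalf Real.sin :=
  bddHolderHalf_of_lipschitz Real.abs_sin_le_one Real.abs_sin_sub_sin_le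

theorem cos_mem_Icc (x : ℝ) : Real.cos x ∈ Icc (-1 : ℝ) 1 :=
  ⟨Real.neg_one_le_cos x, Real.cos_le_one x⟩

theorem bddHolderHalf_comp_cos {φ : ℝ → ℝ} (hc : ContinuousOn φ (Icc (-1) 1)) {C : ℝ}
    (hφ : ∀ x ∈ Icc (-1 : ℝ) 1, ∀ y ∈ Icc (-1 : ℝ) 1, |φ x - φ y| ≤ C * |x - y| ^ (1 / 2 : ℝ)) :
    BddHolderHalf fun θ => φ (Real.cos θ) := by
  obtain ⟨M, hM⟩ := isCompact_Icc.exists_bound_of_continuousOn hc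
  have hM0 : 0 ≤ M := (norm_nonneg _).trans (hM _ (cos_mem_Icc 0))
  refine ⟨M + |C|, by positivity, fun x => ?_, fun x y => ?_⟩
  · exact (hM _ (cos_mem_Icc x)).trans (by linarith [abs_nonneg C])
  · calc _ ≤ C * |Real.cos x - Real.cos y| ^ (1 / 2 : ℝ) := hφ _ (cos_mem_Icc x) _ (cos_mem_Icc y)
      _ ≤ (M + |C|) * |x - y| ^ (1 / 2 : ℝ) :=
          mul_le_mul (by linarith [le_abs_self C]) (Real.rpow_le_rpow (abs_nonneg _)
            (Real.abs_cos_sub_cos_le x y) (by norm_num)) (by positivity) (by positivity)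

/-- Translation by `π/n` reverses the sign of `cos(nx)`. Averaging over a full period replaces `G`
by `G(x) - G(x + π/n)`, which is `O(n^(-1/2))`; evenness passes from `[0, π]` to the period. -/
theorem abs_integral_mul_cos_le {G : ℝ → ℝ} (hc : Continuous G) (hG : BddHolderHalf G)
    (heven : ∀ x, G (-x) = G x) (hper : Function.Periodic G (2 * Real.pi)) :
    ∃ K, ∀ n : ℕ, 0 < n → |∫ x in (0 : ℝ)..Real.pi, G x * Real.cos (n * x)| ≤
      K * (n : ℝ) ^ (-(1 / 2) : ℝ) := by
  obtain ⟨K, hK, -, hh⟩ := hG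
  refine ⟨K * Real.pi ^ (1 / 2 : ℝ) * Real.pi, fun n hn => ?_⟩
  have hn0 : (0 : ℝ) < n := by exact_mod_cast hn
  have hπ := Real.pi_pos
  set φ : ℝ → ℝ := fun x => G x * Real.cos (n * x) with hφ
  have hφc : Continuous φ := by fun_prop
  have hφp : Function.Periodic φ (2 * Real.pi) := by
    intro x
    simp only [hφ]
    rw [hper x, mul_add, Real.cos_add_nat_mul_two_pi]
  have h1 : ∫ x in (-Real.pi)..Real.pi, φ x = 2 * ∫ x in (0 : ℝ)..Real.pi, φ x := by
    have h2 : ∫ x in (-Real.pi)..0, φ x = ∫ x in (0 : ℝ)..Real.pi, φ x := by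
      have := intervalIntegral.integral_comp_neg (a := 0) (b := Real.pi) φ
      rw [neg_zero] at this
      rw [← this]
      refine intervalIntegral.integral_congr fun x _ => ?_
      simp [hφ, heven]
    rw [← intervalIntegral.integral_add_adjacent_intervals (hφc.intervalIntegrable _ 0)
      (hφc.intervalIntegrable _ _), h2, two_mul]
  have h3 : ∫ x in (-Real.pi)..Real.pi, φ (x + Real.pi / n) = ∫ x in (-Real.pi)..Real.pi, φ x := by
    rw [intervalIntegral.integral_comp_add_right]
    have := hφp.intervalIntegral_add_eq (-Real.pi + Real.pi / n) (-Real.pi)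
    rw [show -Real.pi + Real.pi / n + 2 * Real.pi = Real.pi + Real.pi / n by ring,
      show -Real.pi + 2 * Real.pi = Real.pi by ring] at this
    exact this
  have h4 : ∀ x, φ x + φ (x + Real.pi / n) =
      (G x - G (x + Real.pi / n)) * Real.cos (n * x) := by
    intro x
    simp only [hφ]
    rw [mul_add, mul_div_cancel₀ _ hn0.ne', Real.cos_add_pi]
    ring
  have h5 : 4 * ∫ x in (0 : ℝ)..Real.pi, φ x =
      ∫ x in (-Real.pi)..Real.pi, (G x - G (x + Real.pi / n)) * Real.cos (n * x) := by
    simp_rw [← h4]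
    rw [intervalIntegral.integral_add (hφc.intervalIntegrable _ _)
      (Continuous.intervalIntegrable (by fun_prop) _ _), h3, h1]
    ring
  have h6 : ‖∫ x in (-Real.pi)..Real.pi, (G x - G (x + Real.pi / n)) * Real.cos (n * x)‖ ≤
      (K * (Real.pi / n) ^ (1 / 2 : ℝ)) * |Real.pi - (-Real.pi)| := by
    refine intervalIntegral.norm_integral_le_of_norm_le_const fun x _ => ?_
    rw [Real.norm_eq_abs, abs_mul]
    have := hh x (x + Real.pi / n)
    rw [sub_add_cancel_left, abs_neg, abs_of_pos (div_pos hπ hn0)] at this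
    calc _ ≤ (K * (Real.pi / n) ^ (1 / 2 : ℝ)) * 1 :=
          mul_le_mul this (Real.abs_cos_le_one _) (abs_nonneg _) (by positivity)
      _ = _ := mul_one _
  rw [← h5, Real.norm_eq_abs, abs_mul, sub_neg_eq_add, abs_of_pos (by positivity : 0 < Real.pi + Real.pi),
    Real.div_rpow hπ.le hn0.le, abs_of_pos (by norm_num : (0 : ℝ) < 4)] at h6
  rw [Real.rpow_neg hn0.le]
  have h7 : 0 ≤ K * (Real.pi ^ (1 / 2 : ℝ) / (n : ℝ) ^ (1 / 2 : ℝ)) * Real.pi := by positivity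
  calc _ ≤ K * (Real.pi ^ (1 / 2 : ℝ) / (n : ℝ) ^ (1 / 2 : ℝ)) * Real.pi := by linarith
    _ = _ := by ring

theorem integral_comp_cos_mul_cos {f f₁ f₂ : ℝ → ℝ} (hf₂ : ContinuousOn f₂ (Icc (-1) 1))
    (h₁ : ∀ x ∈ Icc (-1 : ℝ) 1, HasDerivWithinAt f (f₁ x) (Icc (-1) 1) x)
    (h₂ : ∀ x ∈ Icc (-1 : ℝ) 1, HasDerivWithinAt f₁ (f₂ x) (Icc (-1) 1) x)
    {n : ℕ} (hn : 0 < n) :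
    ∫ x in (0 : ℝ)..Real.pi, f (Real.cos x) * Real.cos (n * x) = -((n : ℝ) ^ 2)⁻¹ *
      ∫ x in (0 : ℝ)..Real.pi, (f₂ (Real.cos x) * (Real.sin x * Real.sin x) -
        f₁ (Real.cos x) * Real.cos x) * Real.cos (n * x) := by
  have hn0 : (n : ℝ) ≠ 0 := by exact_mod_cast hn.ne'
  have hd : ∀ {φ φ' : ℝ → ℝ}, (∀ x ∈ Icc (-1 : ℝ) 1, HasDerivWithinAt φ (φ' x) (Icc (-1) 1) x) →
      ∀ x, HasDerivAt (fun θ => φ (Real.cos θ)) (φ' (Real.cos x) * -Real.sin x) x := by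
    intro φ φ' h x
    rw [← hasDerivWithinAt_univ]
    exact (h _ (cos_mem_Icc x)).comp x (Real.hasDerivAt_cos x).hasDerivWithinAt
      fun y _ => cos_mem_Icc y
  have hcont : ∀ {φ : ℝ → ℝ}, ContinuousOn φ (Icc (-1) 1) → Continuous fun x => φ (Real.cos x) :=
    fun h => h.comp_continuous Real.continuous_cos cos_mem_Icc
  have c0 := hcont fun x hx => (h₁ x hx).continuousWithinAt
  have c1 := hcont fun x hx => (h₂ x hx).continuousWithinAt
  have c2 := hcont hf₂
  have k0 : Continuous fun x => f (Real.cos x) * Real.cos (n * x) := c0.mul (by fun_prop)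
  have k1 : Continuous fun x => ((n : ℝ) ^ 2)⁻¹ * ((f₂ (Real.cos x) * (Real.sin x * Real.sin x) -
      f₁ (Real.cos x) * Real.cos x) * Real.cos (n * x)) :=
    continuous_const.mul (((c2.mul (by fun_prop)).sub (c1.mul (by fun_prop))).mul (by fun_prop))
  -- An explicit primitive encodes two integrations by parts; it vanishes at `0` and `π` since
  -- `sin(nx)` and `sin x` do.
  have hprim : ∀ x, HasDerivAt (fun x => f (Real.cos x) * (Real.sin (n * x) * (n : ℝ)⁻¹) +
      f₁ (Real.cos x) * -Real.sin x * (Real.cos (n * x) * ((n : ℝ) ^ 2)⁻¹))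
      (f (Real.cos x) * Real.cos (n * x) + ((n : ℝ) ^ 2)⁻¹ *
        ((f₂ (Real.cos x) * (Real.sin x * Real.sin x) -
          f₁ (Real.cos x) * Real.cos x) * Real.cos (n * x))) x := by
    intro x
    have hlin : HasDerivAt (fun x : ℝ => (n : ℝ) * x) n x := by
      simpa using (hasDerivAt_id x).const_mul (n : ℝ)
    have hs := hlin.sin.mul_const (n : ℝ)⁻¹
    have hc := hlin.cos.mul_const ((n : ℝ) ^ 2)⁻¹
    refine (((hd h₁ x).mul hs).add
      (((hd h₂ x).mul (Real.hasDerivAt_sin x).neg).mul hc)).congr_deriv ?_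
    simp only [Pi.mul_apply, Pi.neg_apply]
    field_simp
    ring
  have hint := intervalIntegral.integral_eq_sub_of_hasDerivAt (a := 0) (b := Real.pi)
    (fun x _ => hprim x) ((k0.add k1).intervalIntegrable _ _)
  rw [intervalIntegral.integral_add (k0.intervalIntegrable _ _) (k1.intervalIntegrable _ _),
    intervalIntegral.integral_const_mul] at hint
  simp only [Real.sin_nat_mul_pi, Real.sin_pi, mul_zero, Real.sin_zero, zero_mul, neg_zero,
    add_zero, sub_zero] at hint
  linarith

theorem exists_holderHalf_of_contDiffOn {φ : ℝ → ℝ} (hφ : ContDiffOn ℝ 1 φ (Icc (-1) 1)) :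
    ∃ C, ∀ x ∈ Icc (-1 : ℝ) 1, ∀ y ∈ Icc (-1 : ℝ) 1,
      |φ x - φ y| ≤ C * |x - y| ^ (1 / 2 : ℝ) := by
  have hud : UniqueDiffOn ℝ (Icc (-1 : ℝ) 1) := uniqueDiffOn_Icc (by norm_num)
  obtain ⟨M, hM⟩ := isCompact_Icc.exists_bound_of_continuousOn
    (hφ.continuousOn_derivWithin hud le_rfl)
  have hM0 : 0 ≤ M := (norm_nonneg _).trans (hM _ (cos_mem_Icc 0))
  refine ⟨M * 2, fun x hx y hy => ?_⟩
  have h := (convex_Icc (-1 : ℝ) 1).norm_image_sub_le_of_norm_derivWithin_le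
    (hφ.differentiableOn one_ne_zero) hM hy hx
  rw [Real.norm_eq_abs, Real.norm_eq_abs] at h
  rw [mul_assoc]
  refine h.trans (mul_le_mul_of_nonneg_left (le_two_mul_rpow_half (abs_nonneg _) ?_ le_rfl) hM0)
  exact abs_le.2 ⟨by linarith [hx.1, hy.2], by linarith [hx.2, hy.1]⟩

/-- As `μ < 1`, necessarily `p ≥ 2`. If `p = 2` then `μ ≥ 1/2`; if `p ≥ 3` the second derivative is
itself `C^1`. -/
theorem LipClass.holderHalf {p : ℕ} {μ : ℝ} (hμ1 : μ < 1)
    (hpμ : 5 / 2 ≤ (p : ℝ) + μ) {f : ℝ → ℝ} (hf : LipClass p μ f) :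
    ContDiffOn ℝ 2 f (Icc (-1) 1) ∧ ∃ C, ∀ x ∈ Icc (-1 : ℝ) 1, ∀ y ∈ Icc (-1 : ℝ) 1,
      |iteratedDerivWithin 2 f (Icc (-1) 1) x - iteratedDerivWithin 2 f (Icc (-1) 1) y| ≤
        C * |x - y| ^ (1 / 2 : ℝ) := by
  obtain ⟨hf, C, hC⟩ := hf
  have hud : UniqueDiffOn ℝ (Icc (-1 : ℝ) 1) := uniqueDiffOn_Icc (by norm_num)
  have hp : 2 ≤ p := by
    by_contra! h
    have : (p : ℝ) ≤ 1 := by exact_mod_cast Nat.lt_succ_iff.1 h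
    linarith
  refine ⟨hf.of_le (by exact_mod_cast hp), ?_⟩
  rcases hp.eq_or_lt with rfl | hp3
  · refine ⟨|C| * 2 ^ (μ - 1 / 2), fun x hx y hy => (hC x hx y hy).trans ?_⟩
    have hμ : 0 ≤ μ - 1 / 2 := by push_cast at hpμ; linarith
    have h2 : |x - y| ≤ 2 := abs_le.2 ⟨by linarith [hx.1, hy.2], by linarith [hx.2, hy.1]⟩
    calc C * |x - y| ^ μ ≤ |C| * (|x - y| ^ (μ - 1 / 2) * |x - y| ^ (1 / 2 : ℝ)) := by
          rw [← Real.rpow_add_of_nonneg (abs_nonneg _) hμ (by norm_num), sub_add_cancel]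
          gcongr
          exact le_abs_self C
      _ ≤ |C| * (2 ^ (μ - 1 / 2) * |x - y| ^ (1 / 2 : ℝ)) := by gcongr
      _ = _ := by ring
  · refine exists_holderHalf_of_contDiffOn ?_
    have h3 : ContDiffOn ℝ 3 f (Icc (-1) 1) := hf.of_le (by exact_mod_cast hp3)
    have h4 := (h3.derivWithin hud (m := 2) (by norm_num)).derivWithin hud (m := 1) (by norm_num)
    rwa [iteratedDerivWithin_succ, iteratedDerivWithin_one]

theorem exists_cosCoeff_le {f : ℝ → ℝ} (hf : ContDiffOn ℝ 2 f (Icc (-1) 1)) {C : ℝ}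
    (hC : ∀ x ∈ Icc (-1 : ℝ) 1, ∀ y ∈ Icc (-1 : ℝ) 1,
      |iteratedDerivWithin 2 f (Icc (-1) 1) x - iteratedDerivWithin 2 f (Icc (-1) 1) y| ≤
        C * |x - y| ^ (1 / 2 : ℝ)) :
    ∃ K, ∀ n : ℕ, 0 < n → |∫ x in (0 : ℝ)..Real.pi, f (Real.cos x) * Real.cos (n * x)| ≤
      K * (n : ℝ) ^ (-(5 / 2) : ℝ) := by
  have hud : UniqueDiffOn ℝ (Icc (-1 : ℝ) 1) := uniqueDiffOn_Icc (by norm_num)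
  have e2 : iteratedDerivWithin 2 f (Icc (-1) 1) =
      derivWithin (derivWithin f (Icc (-1) 1)) (Icc (-1) 1) := by
    ext x
    rw [iteratedDerivWithin_succ, iteratedDerivWithin_one]
  rw [e2] at hC
  set f₁ := derivWithin f (Icc (-1) 1) with hf₁
  set f₂ := derivWithin f₁ (Icc (-1) 1) with hf₂
  have hd1 : ContDiffOn ℝ 1 f₁ (Icc (-1) 1) := hf.derivWithin hud (by norm_num)
  have hc2 : ContinuousOn f₂ (Icc (-1) 1) := hd1.continuousOn_derivWithin hud le_rfl
  obtain ⟨C', hC'⟩ := exists_holderHalf_of_contDiffOn hd1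
  have b1 := bddHolderHalf_comp_cos hd1.continuousOn hC'
  have b2 := bddHolderHalf_comp_cos hc2 hC
  have c1 : Continuous fun x => f₁ (Real.cos x) :=
    hd1.continuousOn.comp_continuous Real.continuous_cos cos_mem_Icc
  have c2 : Continuous fun x => f₂ (Real.cos x) :=
    hc2.comp_continuous Real.continuous_cos cos_mem_Icc
  obtain ⟨K, hK⟩ := abs_integral_mul_cos_le
    (G := fun x => f₂ (Real.cos x) * (Real.sin x * Real.sin x) - f₁ (Real.cos x) * Real.cos x)
    ((c2.mul (by fun_prop)).sub (c1.mul (by fun_prop)))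
    ((b2.mul (bddHolderHalf_sin.mul bddHolderHalf_sin)).sub (b1.mul bddHolderHalf_cos))
    (fun x => by simp) (fun x => by simp)
  refine ⟨K, fun n hn => ?_⟩
  have hn0 : (0 : ℝ) < n := by exact_mod_cast hn
  rw [integral_comp_cos_mul_cos hc2
    (fun x hx => (hf.differentiableOn two_ne_zero x hx).hasDerivWithinAt)
    (fun x hx => (hd1.differentiableOn one_ne_zero x hx).hasDerivWithinAt) hn, abs_mul, abs_neg,
    abs_of_pos (by positivity)]
  calc _ ≤ ((n : ℝ) ^ 2)⁻¹ * (K * (n : ℝ) ^ (-(1 / 2) : ℝ)) := by gcongr; exact hK n hn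
    _ = K * ((n : ℝ) ^ (-2 : ℝ) * (n : ℝ) ^ (-(1 / 2) : ℝ)) := by
        rw [Real.rpow_neg hn0.le 2, Real.rpow_two]; ring
    _ = _ := by rw [← Real.rpow_add hn0]; norm_num

/-- Under `t = cos θ` the weighted measure becomes `2 sin²(θ/2) dθ`. One factor `sin(θ/2)` cancels
the denominator of `u_n`, the other gives `2 sin((n + 1/2)θ) sin(θ/2) = cos(nθ) - cos((n + 1)θ)`. -/
theorem jacobiCoeff_eq {f : ℝ → ℝ} (hf : ContinuousOn f (Icc (-1) 1)) (n : ℕ) :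
    jacobiCoeff f n = (√Real.pi)⁻¹ *
      ((∫ x in (0 : ℝ)..Real.pi, f (Real.cos x) * Real.cos (n * x)) -
        ∫ x in (0 : ℝ)..Real.pi, f (Real.cos x) * Real.cos ((n + 1 : ℕ) * x)) := by
  have c0 : Continuous fun x => f (Real.cos x) :=
    hf.comp_continuous Real.continuous_cos cos_mem_Icc
  have k0 : Continuous fun x => f (Real.cos x) * Real.cos (n * x) := c0.mul (by fun_prop)
  have k1 : Continuous fun x => f (Real.cos x) * Real.cos ((n + 1 : ℕ) * x) :=
    c0.mul (by fun_prop)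
  rw [jacobiCoeff, intervalIntegral.integral_of_le (by norm_num), ← integral_Icc_eq_integral_Ioc,
    ← Real.bijOn_cos.image_eq, integral_image_eq_integral_abs_deriv_smul measurableSet_Icc
      (fun x _ => (Real.hasDerivAt_cos x).hasDerivWithinAt) Real.injOn_cos,
    ← intervalIntegral.integral_sub (k0.intervalIntegrable _ _) (k1.intervalIntegrable _ _),
    ← intervalIntegral.integral_const_mul,
    intervalIntegral.integral_of_le Real.pi_pos.le, integral_Icc_eq_integral_Ioo,
    integral_Ioc_eq_integral_Ioo]
  -- The open interval keeps `sin(θ/2)` and `cos(θ/2)` positive.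
  refine setIntegral_congr_fun measurableSet_Ioo fun θ hθ => ?_
  have hs : 0 < Real.sin (θ / 2) :=
    Real.sin_pos_of_pos_of_lt_pi (by linarith [hθ.1]) (by linarith [hθ.2, Real.pi_pos])
  have hc : 0 < Real.cos (θ / 2) :=
    Real.cos_pos_of_mem_Ioo ⟨by linarith [hθ.1, Real.pi_pos], by linarith [hθ.2]⟩
  have hU := jacobiU_cos n θ
  have e1 := Real.cos_sq' (θ / 2)
  have e2 := Real.cos_two_mul (θ / 2)
  have e3 := Real.sin_two_mul (θ / 2)
  rw [show 2 * (θ / 2) = θ by ring] at e2 e3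
  have w1 : (1 - Real.cos θ) ^ (1 / 2 : ℝ) = √2 * Real.sin (θ / 2) := by
    rw [← Real.sqrt_eq_rpow, show 1 - Real.cos θ = 2 * Real.sin (θ / 2) ^ 2 by linarith,
      Real.sqrt_mul (by norm_num), Real.sqrt_sq hs.le]
  have w2 : (1 + Real.cos θ) ^ (-1 / 2 : ℝ) = (√2 * Real.cos (θ / 2))⁻¹ := by
    rw [show (-1 / 2 : ℝ) = -(1 / 2) by norm_num,
      Real.rpow_neg (by linarith [Real.neg_one_le_cos θ]), ← Real.sqrt_eq_rpow,
      show 1 + Real.cos θ = 2 * Real.cos (θ / 2) ^ 2 by linarith,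
      Real.sqrt_mul (by norm_num), Real.sqrt_sq hc.le]
  have h4 : Real.cos (n * θ) - Real.cos ((n + 1 : ℕ) * θ) =
      2 * Real.sin ((n + 1 / 2) * θ) * Real.sin (θ / 2) := by
    rw [show (n : ℝ) * θ = (n + 1 / 2) * θ - θ / 2 by ring,
      show ((n + 1 : ℕ) : ℝ) * θ = (n + 1 / 2) * θ + θ / 2 by push_cast; ring,
      Real.cos_sub, Real.cos_add]
    ring
  simp only [smul_eq_mul, jacobiWeight]
  rw [w1, w2, abs_neg, e3, abs_of_pos (by positivity), ← mul_sub, h4]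
  have h2 : √(2 : ℝ) ≠ 0 := by positivity
  calc _ = f (Real.cos θ) * (jacobiU n (Real.cos θ) * Real.sin (θ / 2)) *
        (2 * Real.sin (θ / 2)) := by field_simp
    _ = _ := by rw [hU]; ring

theorem exists_jacobiCoeff_le {p : ℕ} {μ : ℝ} (hμ1 : μ < 1) (hpμ : 5 / 2 ≤ (p : ℝ) + μ)
    {f : ℝ → ℝ} (hf : LipClass p μ f) :
    ∃ K, ∀ n : ℕ, |jacobiCoeff f (n + 1)| ≤ K * ((n : ℝ) + 1) ^ (-(5 / 2) : ℝ) := by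
  obtain ⟨hf2, C, hC⟩ := hf.holderHalf hμ1 hpμ
  obtain ⟨K, hK⟩ := exists_cosCoeff_le hf2 hC
  have hK0 : 0 ≤ K := by simpa using (abs_nonneg _).trans (hK 1 one_pos)
  refine ⟨2 * K, fun n => ?_⟩
  have h1 := hK (n + 1) (by omega)
  have h2 := hK (n + 1 + 1) (by omega)
  have h3 : ((n + 1 + 1 : ℕ) : ℝ) ^ (-(5 / 2) : ℝ) ≤ ((n + 1 : ℕ) : ℝ) ^ (-(5 / 2) : ℝ) :=
    Real.rpow_le_rpow_of_nonpos (by positivity) (by push_cast; linarith) (by norm_num)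
  have h4 := mul_le_mul_of_nonneg_left h3 hK0
  rw [jacobiCoeff_eq hf2.continuousOn, abs_mul, abs_of_pos (inv_pos.2 (Real.sqrt_pos.2 Real.pi_pos))]
  refine (mul_le_of_le_one_left (abs_nonneg _) inv_sqrt_pi_le_one).trans ((abs_sub _ _).trans ?_)
  rw [← Nat.cast_add_one]
  linarith

end Decay

/-! ### Convergence of the kernel series in `L^α` -/

section Series

theorem continuous_jacobiWeight {η τ : ℝ} (hη : 0 ≤ η) (hτ : 0 ≤ τ) :
    Continuous (jacobiWeight η τ) :=
  ((continuous_const.sub continuous_id).rpow_const fun _ => Or.inr hη).mul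
    ((continuous_const.add continuous_id).rpow_const fun _ => Or.inr hτ)

theorem summable_abs_mul_rpow {b : ℕ → ℝ} {K : ℝ}
    (hb : ∀ n : ℕ, |b (n + 1)| ≤ K * ((n : ℝ) + 1) ^ (-(5 / 2) : ℝ)) :
    Summable fun n : ℕ => |b n| * ((2 * n + 1) * (2 * n + 1 : ℝ) ^ (1 / 4 : ℝ)) := by
  rw [← summable_nat_add_iff 1]
  have hs : Summable fun n : ℕ => K * 3 ^ (5 / 4 : ℝ) * ((n + 1 : ℕ) : ℝ) ^ (-(5 / 4) : ℝ) :=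
    (((summable_nat_add_iff 1).2 (Real.summable_nat_rpow.2 (by norm_num)))).mul_left _
  refine hs.of_nonneg_of_le (fun n => by positivity) fun n => ?_
  have hn : (0 : ℝ) < (n : ℝ) + 1 := by positivity
  -- Since `2(n + 1) + 1 ≤ 3(n + 1)`; the resulting exponent is `-5/2 + 5/4 = -5/4 < -1`.
  have h1 : (2 * ((n + 1 : ℕ) : ℝ) + 1) * (2 * ((n + 1 : ℕ) : ℝ) + 1) ^ (1 / 4 : ℝ) ≤
      3 ^ (5 / 4 : ℝ) * ((n : ℝ) + 1) ^ (5 / 4 : ℝ) := by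
    rw [← Real.mul_rpow (by norm_num) hn.le]
    calc _ = (2 * ((n + 1 : ℕ) : ℝ) + 1) ^ (5 / 4 : ℝ) := by
          rw [show (5 / 4 : ℝ) = 1 + 1 / 4 by norm_num, Real.rpow_add (by positivity),
            Real.rpow_one]
      _ ≤ _ := by
          gcongr
          push_cast
          linarith
  calc _ ≤ K * ((n : ℝ) + 1) ^ (-(5 / 2) : ℝ) * (3 ^ (5 / 4 : ℝ) * ((n : ℝ) + 1) ^ (5 / 4 : ℝ)) :=
        mul_le_mul (hb n) h1 (by positivity) ((abs_nonneg _).trans (hb n))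
    _ = K * 3 ^ (5 / 4 : ℝ) * (((n : ℝ) + 1) ^ (-(5 / 2) : ℝ) * ((n : ℝ) + 1) ^ (5 / 4 : ℝ)) := by
        ring
    _ = _ := by rw [← Real.rpow_add hn]; norm_num

/-- On a bounded interval `L^2` suffices, and the square `(1 - t)^(-3/4)` is integrable. -/
theorem memLp_one_sub_rpow {α : ℝ} (hα : α ≤ 2) :
    MemLp (fun t : ℝ => (1 - t) ^ (-(3 / 8) : ℝ)) (ENNReal.ofReal α)
      (volume.restrict (Icc (-1) 1)) := by
  have hm : Measurable fun t : ℝ => (1 - t) ^ (-(3 / 8) : ℝ) := by fun_prop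
  refine MemLp.mono_exponent (q := 2) ?_ (by
    rw [← ENNReal.ofReal_ofNat]; exact ENNReal.ofReal_le_ofReal hα)
  rw [memLp_two_iff_integrable_sq hm.aestronglyMeasurable]
  have h1 : IntervalIntegrable (fun x : ℝ => x ^ (-(3 / 4) : ℝ)) volume 0 2 :=
    intervalIntegral.intervalIntegrable_rpow' (by norm_num)
  have h2 := (h1.comp_sub_left 1).symm
  norm_num at h2
  rw [intervalIntegrable_iff_integrableOn_Icc_of_le (by norm_num)] at h2
  refine IntegrableOn.congr_fun h2 (fun t ht => ?_) measurableSet_Icc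
  rw [← Real.rpow_natCast, ← Real.rpow_mul (by linarith [ht.2])]
  norm_num

variable {f : ℝ → ℝ}

/-- The bound `2n + 1` is spent on `y`, where uniformity up to `1` is needed, and the interpolated
bound on `t`, where only integrability matters. -/
theorem abs_term_le (n : ℕ) {y t : ℝ} (hy : y ∈ Icc (-1 : ℝ) 1) (ht : t ∈ Ico (-1 : ℝ) 1) :
    |jacobiCoeff f n * jacobiU n y * jacobiU n t| ≤
      |jacobiCoeff f n| * ((2 * n + 1) * (2 * n + 1 : ℝ) ^ (1 / 4 : ℝ)) *
        (2 * (1 - t) ^ (-(3 / 8) : ℝ)) := by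
  rw [abs_mul, abs_mul]
  calc _ ≤ |jacobiCoeff f n| * (2 * n + 1) *
        ((2 * n + 1) ^ (1 / 4 : ℝ) * (2 * (1 - t) ^ (-(3 / 8) : ℝ))) := by
        gcongr
        · exact abs_jacobiU_le n hy
        · exact abs_jacobiU_le_rpow n ht
    _ = _ := by ring

theorem summable_term (hf : Summable fun n : ℕ =>
    |jacobiCoeff f n| * ((2 * n + 1) * (2 * n + 1 : ℝ) ^ (1 / 4 : ℝ))) {y t : ℝ}
    (hy : y ∈ Icc (-1 : ℝ) 1) (ht : t ∈ Ico (-1 : ℝ) 1) :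
    Summable fun k : ℕ => jacobiCoeff f k * jacobiU k y * jacobiU k t :=
  Summable.of_norm_bounded (hf.mul_right _) fun n => abs_term_le n hy ht

theorem abs_jacobiSum_sub_le (hf : Summable fun n : ℕ =>
    |jacobiCoeff f n| * ((2 * n + 1) * (2 * n + 1 : ℝ) ^ (1 / 4 : ℝ))) {y t : ℝ}
    (hy : y ∈ Icc (-1 : ℝ) 1) (ht : t ∈ Ico (-1 : ℝ) 1) (n : ℕ) :
    |jacobiSum f y t - ∑ k ∈ Finset.range n, jacobiCoeff f k * jacobiU k y * jacobiU k t| ≤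
      (∑' k : ℕ, |jacobiCoeff f (k + n)| *
        ((2 * (k + n : ℕ) + 1) * (2 * (k + n : ℕ) + 1 : ℝ) ^ (1 / 4 : ℝ))) *
          (2 * (1 - t) ^ (-(3 / 8) : ℝ)) := by
  have hs := summable_term hf hy ht
  rw [jacobiSum, ← hs.sum_add_tsum_nat_add n, add_sub_cancel_left, ← tsum_mul_right, ← Real.norm_eq_abs]
  have hg := ((summable_nat_add_iff n).2 hf).mul_right (2 * (1 - t) ^ (-(3 / 8) : ℝ))
  exact tsum_of_norm_bounded hg.hasSum fun k => abs_term_le (k + n) hy ht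

/-- The remainder is at most a tail of a convergent numerical series times one fixed `L^α` function.
The case `n = 0` gives membership in `L^α`. -/
theorem tendsto_eLpNorm_jacobiSum (hf : Summable fun n : ℕ =>
    |jacobiCoeff f n| * ((2 * n + 1) * (2 * n + 1 : ℝ) ^ (1 / 4 : ℝ))) {y : ℝ}
    (hy : y ∈ Icc (-1 : ℝ) 1) {α η τ : ℝ} (hα : α ≤ 2) (hη : 0 ≤ η) (hτ : 0 ≤ τ) :
    MemLp (fun t => jacobiSum f y t * jacobiWeight η τ t) (ENNReal.ofReal α)
        (volume.restrict (Icc (-1) 1)) ∧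
      Tendsto (fun n => eLpNorm (fun t => jacobiSum f y t * jacobiWeight η τ t -
        ∑ k ∈ Finset.range n, jacobiCoeff f k * jacobiU k y * (jacobiU k t * jacobiWeight η τ t))
        (ENNReal.ofReal α) (volume.restrict (Icc (-1) 1))) atTop (𝓝 0) := by
  have hw := continuous_jacobiWeight hη hτ
  have hG := memLp_one_sub_rpow hα
  obtain ⟨M, hM⟩ := isCompact_Icc.exists_bound_of_continuousOn (hw.continuousOn (s := Icc (-1) 1))
  set R : ℕ → ℝ := fun n => ∑' k : ℕ, |jacobiCoeff f (k + n)| *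
    ((2 * (k + n : ℕ) + 1) * (2 * (k + n : ℕ) + 1 : ℝ) ^ (1 / 4 : ℝ)) with hR
  have hR0 : Tendsto R atTop (𝓝 0) := tendsto_sum_nat_add fun n : ℕ =>
    |jacobiCoeff f n| * ((2 * n + 1) * (2 * n + 1 : ℝ) ^ (1 / 4 : ℝ))
  -- The point `t = 1`, where the series may diverge, is null.
  have hae : ∀ᵐ t ∂(volume.restrict (Icc (-1 : ℝ) 1)), t ∈ Ico (-1 : ℝ) 1 := by
    rw [restrict_Ico_eq_restrict_Icc.symm]
    exact ae_restrict_mem measurableSet_Ico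
  have hbound : ∀ n, ∀ᵐ t ∂(volume.restrict (Icc (-1 : ℝ) 1)),
      ‖jacobiSum f y t * jacobiWeight η τ t - ∑ k ∈ Finset.range n,
        jacobiCoeff f k * jacobiU k y * (jacobiU k t * jacobiWeight η τ t)‖ ≤
        R n * 2 * M * ‖(1 - t) ^ (-(3 / 8) : ℝ)‖ := by
    intro n
    filter_upwards [hae] with t ht
    have h1 := abs_jacobiSum_sub_le hf hy ht n
    have h2 := hM t ⟨ht.1, ht.2.le⟩
    simp_rw [← mul_assoc]
    rw [← Finset.sum_mul, ← sub_mul, norm_mul, Real.norm_eq_abs,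
      Real.norm_of_nonneg (Real.rpow_nonneg (by linarith [ht.2]) _)]
    calc _ ≤ R n * (2 * (1 - t) ^ (-(3 / 8) : ℝ)) * M :=
          mul_le_mul h1 h2 (norm_nonneg _) ((abs_nonneg _).trans h1)
      _ = _ := by ring
  constructor
  · have hmeas : AEStronglyMeasurable (fun t => jacobiSum f y t * jacobiWeight η τ t)
        (volume.restrict (Icc (-1) 1)) := by
      refine aestronglyMeasurable_of_tendsto_ae atTop
        (f := fun (n : ℕ) t => (∑ k ∈ Finset.range n, jacobiCoeff f k * jacobiU k y * jacobiU k t) *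
          jacobiWeight η τ t) (fun n => ?_) ?_
      · refine Continuous.aestronglyMeasurable (Continuous.mul ?_ hw)
        exact continuous_finsetSum _ fun k _ => continuous_const.mul (continuous_jacobiU k)
      · filter_upwards [hae] with t ht
        exact (summable_term hf hy ht).hasSum.tendsto_sum_nat.mul_const _
    refine hG.of_le_mul hmeas (c := R 0 * 2 * M) ?_
    simpa using hbound 0
  · have hlim : Tendsto (fun n => ENNReal.ofReal (R n * 2 * M) *
        eLpNorm (fun t : ℝ => (1 - t) ^ (-(3 / 8) : ℝ)) (ENNReal.ofReal α)
          (volume.restrict (Icc (-1) 1))) atTop (𝓝 0) := by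
      have h1 : Tendsto (fun n => ENNReal.ofReal (R n * 2 * M)) atTop (𝓝 0) := by
        simpa using ENNReal.tendsto_ofReal ((hR0.mul_const 2).mul_const M)
      simpa using ENNReal.Tendsto.mul_const h1 (Or.inr hG.2.ne)
    exact tendsto_of_tendsto_of_tendsto_of_le_of_le tendsto_const_nhds hlim (fun _ => zero_le)
      fun n => eLpNorm_le_mul_eLpNorm_of_ae_le_mul (hbound n) _

end Series

end RandomJacobi

theorem mainTheorem3 {Ω : Type*} [MeasurableSpace Ω] (P : Measure Ω) [IsProbabilityMeasure P]
    (α : ℝ) (hα : α ∈ Icc (1 : ℝ) 2)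
    (X : ℝ → Ω → ℝ) (hX : RandomJacobi.IsSymmetricStable X α P)
    (η τ : ℝ) (hη : 0 ≤ η) (hτ : 0 ≤ τ)
    (p : ℕ) (μ : ℝ) (hμ0 : 0 < μ) (hμ1 : μ < 1) (hpμ : 5 / 2 ≤ (p : ℝ) + μ)
    (f : ℝ → ℝ) (hf : RandomJacobi.LipClass p μ f) :
    -- the random coefficients exist
    (∀ n : ℕ, ∃ Bn : Ω → ℝ, RandomJacobi.IsStochIntegral P X α (-1) 1
      (fun t => RandomJacobi.jacobiU n t * RandomJacobi.jacobiWeight η τ t) Bn) ∧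
    -- the series which defines `f(y, t)` converges
    (∀ y ∈ Icc (-1 : ℝ) 1, ∀ t ∈ Icc (-1 : ℝ) 1, (y, t) ≠ (1, 1) →
      Summable (fun k : ℕ => RandomJacobi.jacobiCoeff f k * RandomJacobi.jacobiU k y *
        RandomJacobi.jacobiU k t)) ∧
    -- the limiting stochastic integral exists
    (∀ y ∈ Icc (-1 : ℝ) 1, ∃ I : Ω → ℝ, RandomJacobi.IsStochIntegral P X α (-1) 1
      (fun t => RandomJacobi.jacobiSum f y t * RandomJacobi.jacobiWeight η τ t) I) ∧
    -- the random series converges to it in probability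
    (∀ B : ℕ → Ω → ℝ,
      (∀ n : ℕ, RandomJacobi.IsStochIntegral P X α (-1) 1
        (fun t => RandomJacobi.jacobiU n t * RandomJacobi.jacobiWeight η τ t) (B n)) →
      ∀ y ∈ Icc (-1 : ℝ) 1, ∀ I : Ω → ℝ,
        RandomJacobi.IsStochIntegral P X α (-1) 1
          (fun t => RandomJacobi.jacobiSum f y t * RandomJacobi.jacobiWeight η τ t) I →
        TendstoInMeasure P
          (fun (n : ℕ) (ω : Ω) => ∑ k ∈ Finset.range (n + 1),
            RandomJacobi.jacobiCoeff f k * B k ω * RandomJacobi.jacobiU k y)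
          atTop I) := by
  open RandomJacobi in
  obtain ⟨c, hc, hchar⟩ := hX.charFun_increment
  have hX' : HasStableIncrements X α c P := ⟨hX.aemeasurable, hX.indepIncrements, hchar⟩
  obtain ⟨K, hK⟩ := exists_jacobiCoeff_le hμ1 hpμ hf
  have hs := summable_abs_mul_rpow hK
  have h11 : (-1 : ℝ) ≤ 1 := by norm_num
  refine ⟨fun n => hX'.exists_isStochIntegral hα.1 hc.le h11 (memLp_of_continuousOn
    ((continuous_jacobiU n).mul (continuous_jacobiWeight hη hτ)).continuousOn _),
    fun y hy t ht hyt => ?_, fun y hy => hX'.exists_isStochIntegral hα.1 hc.le h11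
      (tendsto_eLpNorm_jacobiSum hs hy hα.2 hη hτ).1, fun B hB y hy I hI => ?_⟩
  · rcases ht.2.lt_or_eq with ht1 | rfl
    · exact summable_term hs hy ⟨ht.1, ht1⟩
    -- At `t = 1` the summand's symmetry lets `y < 1` take the role of `t`.
    · have hy1 : y < 1 := lt_of_le_of_ne hy.2 fun h => hyt (by rw [h])
      refine (summable_term hs ht ⟨hy.1, hy1⟩).congr fun k => ?_
      ring
  · have h := hX'.tendstoInMeasure_sum hα.1 hc.le h11 hI hB
      (fun k => jacobiCoeff f k * jacobiU k y)
      (tendsto_eLpNorm_jacobiSum hs hy hα.2 hη hτ).2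
    -- The partial sums here run up to and including `n`, hence the shift by one.
    refine (h.comp (tendsto_add_atTop_nat 1)).congr_left fun n => ae_of_all _ fun ω => ?_
    simp only [Function.comp_apply]
    exact Finset.sum_congr rfl fun k _ => by ring
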